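/- **Setting.** Let $\mathcal S,\mathcal A$ be finite non-empty sets, $A=|\mathcal A|$, and consider the MDP with transition probabilities $\mathcal P(s'|s,a)$, reward $r(s,a,s')$ and discount factor $\gamma\in(0,1)$. For a stationary randomised policy $\pi(a|s)$ let $Q^{\pi}(s,a)=\mathbb E\big[\sum_{n\ge 0}\gamma^n r(s_n,a_n,s_{n+1})\,\big|\,s_0=s,a_0=a\big]$, where the actions $a_1,a_2,\dots$ are drawn from $\pi$; $\pi$ is *optimal* if $Q^{\pi'}(s,a)\le Q^{\pi}(s,a)$ for all policies $\pi'$ and all $(s,a)$. There are $K$ agents, each running its own copy of this MDP, and a graph on the agents; the neighbourhood $\mathcal N_k=\{j:(j,k)\in\mathcal E\}$ contains $k$ itself, and $N_k=|\mathcal N_k|$. **Algorithm.** The initial tables $\widehat Q_{k,0}(s,a)$ are drawn from a law $\mathcal M$ with variance $\sigma_q^2$; the initial states $s_{k,0}$ are arbitrary. At time $n$ every agent $k$ draws, independently of the other agents given the past, an action $a_{k,n}\sim\eta_{k,n}(\cdot|s_{k,n})$, moves to $s_{k,n+1}\sim\mathcal P(\cdot|s_{k,n},a_{k,n})$, and changes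 only the entry $(s,a)=(s_{k,n},a_{k,n})$ of its table: $$\widehat Q_{k,n+1}(s,a)=\widehat Q_{k,n}(s,a)+\alpha_{k,i}(s,a)\Big(r(s,a,s_{k,n+1})+\gamma\max_b\widehat Q_{k,n}(s_{k,n+1},b)-\widehat Q_{k,n}(s,a)\Big),$$ where $i$ is the number of earlier visits of agent $k$ to $(s,a)$. Here $$\eta_{k,n}(a|s)=\frac{e^{\beta_{k,n}(s)\widetilde Q_{k,n}(s,a)}}{\sum_b e^{\beta_{k,n}(s)\widetilde Q_{k,n}(s,b)}},\qquad \widetilde Q_{k,n}=\sigma_{k,n}+\widehat Q_{k,n},$$ $\sigma_{k,n}^2(s,a)=\frac1{N_k-1}\sum_{\ell\in\mathcal N_k}\big(\widehat Q_{\ell,n}(s,a)-\overline Q_{k,n}(s,a)\big)^2$ is the sample variance about the mean $\overline Q_{k,n}$ of the $\widehat Q_{\ell,n}$, $\ell\in\mathcal N_k$, and $$\beta_{k,n}(s)=\frac1{D_{k,n}(s)}\,\ln\log_{1/\alpha}\left[\frac{\sigma_q^{2A}N_k^{-A}}{\prod_{b}\mathbb E\big[\sigma_{k,n}^2(s,b)\,|\,\widetilde{\mathcal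 H}_{k,n}\big]}\right]^{\oplus},\qquad D_{k,n}(s)=\max_{a,b}\big|\widetilde Q_{k,n}(s,a)-\widetilde Q_{k,n}(s,b)\big|,$$ with a constant $0<\alpha\le 1/4$ and $[\psi]^\oplus=\max(\psi,1/\alpha)$. The expectation is over the initial tables only (independent entries with law $\mathcal M$), the transitions in the history $\widetilde{\mathcal H}_{k,n}$ of the agents of $\mathcal N_k$ up to $s_{\ell,n}$ being held fixed. A quotient with denominator $0$ is read as $0$. **Theorem.** Assume that (1) $0\le\alpha_{k,i}(s,a)\le 1$, $\sum_i\alpha_{k,i}(s,a)=\infty$ and $\sum_i\alpha_{k,i}(s,a)^2<\infty$ for all $k,s,a$; (2) the $\widehat Q_{k,0}(s,a)$, over all $k,s,a$, are independent with law $\mathcal M$, which has bounded support and mean $0$; (3) every state can be reached from every other state in finitely many transitions of positive probability, for suitable actions; (4) the rewards are bounded. Then there is an optimal policy $\pi^\star$, and almost surely, for every agent $k$: every state-action pair $(s,a)$ is visited by agent $k$ infinitely often; $\widehat Q_{k,n}(s,a)\to Q^{\pi^\star}(s,a)$ for all $(s,a)$; and there is a time from which on every policy that is greedy with respect to $\widehat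 Q_{k,n}$ (selects only maximisers of $\widehat Q_{k,n}(s,\cdot)$) is optimal. -/

import Mathlib

open MeasureTheory ProbabilityTheory Filter Topology
open scoped ENNReal

/-! ### Laws of discrete-time processes with finitely many values -/

/-- The law of independent random variables with marginal laws `p i`. -/
noncomputable def indepPMF {ι X : Type*} [Fintype ι] [Fintype X] (p : ι → PMF X) :
    PMF (ι → X) := by
  classical
  exact PMF.ofFintype (fun x => ∏ i, p i (x i)) (by
    have h := Finset.prod_univ_sum (fun _ : ι => (Finset.univ : Finset X)) (fun i x => p i x)
    rw [Fintype.piFinset_univ] at h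
    rw [← h]
    refine Finset.prod_eq_one fun i _ => ?_
    rw [← tsum_fintype (L := .unconditional _)]
    exact (p i).tsum_coe)

/-- A history up to time `n`, prolonged by a constant to an infinite path. -/
def prolong {X : Type*} {n : ℕ} (h : (i : Finset.Iic n) → X) : ℕ → X :=
  fun i => h ⟨min i n, Finset.mem_Iic.2 (min_le_right i n)⟩

/-- The transition kernel from the history up to time `n` to the value at time `n + 1`. -/
noncomputable def nextKernel {X : Type*} [Finite X] [MeasurableSpace X]
    [MeasurableSingletonClass X] (next : ℕ → (ℕ → X) → PMF X) (n : ℕ) :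
    Kernel ((i : Finset.Iic n) → X) X :=
  Kernel.ofFunOfCountable (fun h => (next n (prolong h)).toMeasure)

instance {X : Type*} [Finite X] [MeasurableSpace X] [MeasurableSingletonClass X]
    (next : ℕ → (ℕ → X) → PMF X) (n : ℕ) : IsMarkovKernel (nextKernel next n) :=
  ⟨fun h => inferInstanceAs (IsProbabilityMeasure (next n (prolong h)).toMeasure)⟩

/-- The law of a process `x₀, x₁, …` such that `x₀` has law `μ₀`, and `xₙ₊₁` has law `next n x`
given `x₀, …, xₙ`. Only the values `x₀, …, xₙ` of the path handed to `next n` are the real ones;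
the later ones are a filler. -/
noncomputable def pathLaw {X : Type*} [Finite X] [MeasurableSpace X] [MeasurableSingletonClass X]
    (μ₀ : PMF X) (next : ℕ → (ℕ → X) → PMF X) : Measure (ℕ → X) :=
  Kernel.trajMeasure (X := fun _ => X) μ₀.toMeasure (nextKernel next)

/-! ### Markov decision processes -/

/-- A discounted Markov decision process: `P s a s'` is the probability of moving from `s` to `s'`
under `a`, and `r s a s'` is the reward of that transition. -/
structure MDP (S A : Type*) where
  P : S → A → PMF S
  r : S → A → S → ℝ
  γ : ℝ
  γ_pos : 0 < γ
  γ_lt_one : γ < 1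

namespace MDP

variable {S A : Type*} (m : MDP S A)

/-- Every state can be reached from every other one in finitely many transitions. -/
def Reachable : Prop :=
  ∀ s t : S, Relation.ReflTransGen (fun x y => ∃ a, 0 < m.P x a y) s t

variable [Fintype S] [MeasurableSpace S] [MeasurableSingletonClass S]
  [Fintype A] [MeasurableSpace A] [MeasurableSingletonClass A]

/-- The law of the state-action sequence started at `(s, a)`, when every later action is drawn
from the policy `π`. -/
noncomputable def policyLaw (π : S → PMF A) (s : S) (a : A) : Measure (ℕ → S × A) :=
  pathLaw (PMF.pure (s, a)) (fun n x =>
    (m.P (x n).1 (x n).2).bind (fun s' => (π s').map (fun a' => (s', a'))))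

/-- The state-action value `Q^π(s, a)`: the expected discounted return. -/
noncomputable def Qval (π : S → PMF A) (s : S) (a : A) : ℝ :=
  ∫ x, ∑' n : ℕ, m.γ ^ n * m.r (x n).1 (x n).2 (x (n + 1)).1 ∂(m.policyLaw π s a)

/-- `π` maximises `Q^π(s, a)` over all policies, at every state-action pair. -/
def IsOptimal (π : S → PMF A) : Prop :=
  ∀ (π' : S → PMF A) (s : S) (a : A), m.Qval π' s a ≤ m.Qval π s a

end MDP

/-- `π` selects only actions that maximise the table `Q`. -/
def IsGreedy {S A : Type*} (π : S → PMF A) (Q : S → A → ℝ) : Prop :=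
  ∀ s a, π s a ≠ 0 → ∀ b, Q s b ≤ Q s a

/-! ### The graph exploration algorithm -/

/-- The number of times `i < n` with `(sᵢ, aᵢ) = (s, a)`. -/
noncomputable def visits {S A : Type*} (st : ℕ → S) (ac : ℕ → A) (n : ℕ) (s : S) (a : A) : ℕ := by
  classical
  exact ((Finset.range n).filter (fun i => st i = s ∧ ac i = a)).card

/-- The data of the algorithm for `K` agents: the MDP of which each agent runs its own copy, the
communication graph, the step sizes (`step k s a i` is the one that agent `k` uses when it has
visited `(s, a)` exactly `i` times before), the law `M` of an initial Q-value, and the constant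
`α`. -/
structure GEA (K : ℕ) (S A : Type*) where
  mdp : MDP S A
  graph : Digraph (Fin K)
  step : Fin K → S → A → ℕ → ℝ
  M : Measure ℝ
  α : ℝ

/-- The operator `[·]^⊕`: truncation from below at level `c`. -/
noncomputable def truncBelow (c ψ : ℝ) : ℝ := by
  classical
  exact if c ≤ ψ then ψ else c

namespace GEA

variable {K : ℕ} {S A : Type*} (g : GEA K S A)

/-- The neighbourhood `{j : (j, k) ∈ E}` of agent `k`. -/
noncomputable def nbhd (k : Fin K) : Finset (Fin K) := by
  classical
  exact Finset.univ.filter (fun j => g.graph.Adj j k)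

/-- The Q-table of agent `k` at time `n`, as a function of its initial table `q` and of its
states `s₀, …, sₙ` and actions `a₀, …, aₙ₋₁`. -/
noncomputable def Qhat (k : Fin K) (q : S → A → ℝ) (st : ℕ → S) (ac : ℕ → A) : ℕ → S → A → ℝ
  | 0 => q
  | n + 1 => fun s a => by
      classical
      exact
        if st n = s ∧ ac n = a then
          Qhat k q st ac n s a + g.step k s a (visits st ac n s a) *
            (g.mdp.r s a (st (n + 1)) + g.mdp.γ * (⨆ b, Qhat k q st ac n (st (n + 1)) b)
              - Qhat k q st ac n s a)
        else Qhat k q st ac n s a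

/-- The sample mean over the neighbourhood of agent `k`. -/
noncomputable def sampleMean (k : Fin K) (x : Fin K → ℝ) : ℝ :=
  (1 / ((g.nbhd k).card : ℝ)) * ∑ l ∈ g.nbhd k, x l

/-- The (unbiased) sample variance over the neighbourhood of agent `k`. -/
noncomputable def sampleVar (k : Fin K) (x : Fin K → ℝ) : ℝ :=
  (1 / (((g.nbhd k).card : ℝ) - 1)) * ∑ l ∈ g.nbhd k, (x l - g.sampleMean k x) ^ 2

variable (q₀ : Fin K → S → A → ℝ) (st : ℕ → Fin K → S) (ac : ℕ → Fin K → A) (n : ℕ)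

/-- `σ_{k,n}^2(s, a)`, when the agents have the initial tables `q₀` and run through the states
`st` and actions `ac` (first argument: time, second argument: agent). -/
noncomputable def sigmaSq (k : Fin K) (s : S) (a : A) : ℝ :=
  g.sampleVar k (fun l => g.Qhat l (q₀ l) (fun i => st i l) (fun i => ac i l) n s a)

/-- The adjusted Q-value `σ_{k,n}(s, a)` plus `Q_{k,n}(s, a)`. -/
noncomputable def Qtilde (k : Fin K) (s : S) (a : A) : ℝ :=
  Real.sqrt (g.sigmaSq q₀ st ac n k s a)
    + g.Qhat k (q₀ k) (fun i => st i k) (fun i => ac i k) n s a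

/-- `D(s)`, the largest difference of two adjusted Q-values of agent `k` at `s`. -/
noncomputable def spread (k : Fin K) (s : S) : ℝ :=
  ⨆ p : A × A, |g.Qtilde q₀ st ac n k s p.1 - g.Qtilde q₀ st ac n k s p.2|

variable [Fintype S] [Fintype A]

/-- The law of the initial tables: all entries independent with law `M`. -/
noncomputable def initLaw : Measure (Fin K → S → A → ℝ) :=
  Measure.pi (fun _ => Measure.pi (fun _ => Measure.pi (fun _ => g.M)))

/-- The expectation of `σ_{k,n}^2(s, a)` given the history of the neighbours: the history is held
fixed and the expectation is taken with respect to the initial tables. -/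
noncomputable def expSigmaSq (k : Fin K) (s : S) (a : A) : ℝ :=
  ∫ q, g.sigmaSq q st ac n k s a ∂g.initLaw

/-- The parameter `β_{k,n}(s)`. -/
noncomputable def beta (k : Fin K) (s : S) : ℝ :=
  (1 / g.spread q₀ st ac n k s) *
    Real.log (Real.logb (1 / g.α) (truncBelow (1 / g.α)
      ((variance id g.M ^ Fintype.card A * (((g.nbhd k).card : ℝ) ^ Fintype.card A)⁻¹) /
        ∏ b : A, g.expSigmaSq st ac n k s b)))

/-- The Boltzmann behavioural policy `η_{k,n}(· | s)`. -/
noncomputable def behav [Nonempty A] (k : Fin K) (s : S) : PMF A :=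
  PMF.normalize
    (fun a => ENNReal.ofReal (Real.exp (g.beta q₀ st ac n k s * g.Qtilde q₀ st ac n k s a)))
    (by
      obtain ⟨a⟩ := ‹Nonempty A›
      refine fun h => ?_
      have := ENNReal.tsum_eq_zero.1 h a
      rw [ENNReal.ofReal_eq_zero] at this
      exact absurd (Real.exp_pos _) (not_lt.2 this))
    (by
      rw [tsum_fintype]
      exact ENNReal.sum_ne_top.2 (fun a _ => ENNReal.ofReal_ne_top))

/-- The law of the states and actions of all agents at time `n`, when the states at time `n` are
`st n`: the agents draw their actions independently from their behavioural policies. -/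
noncomputable def actLaw [Nonempty A] : PMF (Fin K → S × A) :=
  (indepPMF (fun k => g.behav q₀ st ac n k (st n k))).map (fun a k => (st n k, a k))

variable [MeasurableSpace S] [MeasurableSingletonClass S]
  [MeasurableSpace A] [MeasurableSingletonClass A]

/-- The law of the run of the algorithm (`ω n k` is the state-action pair of agent `k` at time `n`)
with initial tables `q₀` and initial states `s₀`. Given the run up to time `n`, the agents move
independently to their states at time `n + 1` and then draw their actions there. -/
noncomputable def runLaw [Nonempty A] (s₀ : Fin K → S) : Measure (ℕ → Fin K → S × A) :=
  pathLaw
    (g.actLaw q₀ (fun _ => s₀) (fun _ _ => Classical.arbitrary A) 0)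
    (fun n ω =>
      (indepPMF (fun k => g.mdp.P (ω n k).1 (ω n k).2)).bind (fun s' =>
        g.actLaw q₀ (fun i k => if i ≤ n then (ω i k).1 else s' k) (fun i k => (ω i k).2) (n + 1)))

/-- The Q-table of agent `k` at time `n` in the run `ω`. -/
noncomputable def runQ (ω : ℕ → Fin K → S × A) (k : Fin K) : S → A → ℝ :=
  g.Qhat k (q₀ k) (fun i => (ω i k).1) (fun i => (ω i k).2) n

end GEA

/-! ### Conditional expectations under `pathLaw` -/

namespace PathLaw

variable {X : Type*}

/-! Two facts carry the theorem: every agent keeps exploring, and Q-learning that keeps exploring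
converges. Both hold for each fixed choice of initial tables; the law of the tables matters only
through the expected variances inside `beta`.

Exploration. The product of `beta` and the spread is at most ln L, where L is the quantity
`exploration`, so each action has probability at least 1/(|A| L) (`one_div_exploration_le_behav`).
Raising an agent's whole initial table by δ raises its later entry at (s, a) by at least δ times
`influence` (`mul_influence_le_Qhat_sub`), and once the step sizes are below 1/2, a visit to (s, a)
at most halves the influence (`exists_influence_ge`). Since the tables of different agents are
independent and their law, unless its variance is 0, charges two separated sets, the expected sample
variance is either 0 or at least a constant times the squared influence
(`exists_mul_influence_sq_le_expSigmaSq`). If a variance is 0, then L = 1. Otherwise the product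
over the actions is at least a constant times 4^(-v), with v the number of visits to s, and a
logarithm to a base of at least 4 turns this into L ≤ C + v (`exists_le_behav`). Action
probabilities thus decay no faster than harmonically. The harmonic series diverges, so by the
conditional Borel-Cantelli lemma (`ae_frequently_iff`) a state that recurs has all its actions
chosen infinitely often; reachability spreads this to all states (`ae_frequently_pair`).

Convergence. Each update averages the visited entry with its Bellman optimality target plus centred
noise. Square summable steps make the weighted noise a convergent martingale
(`ae_exists_tendsto_sum`), and the contraction does the rest (`tendsto_of_async_contraction`). The
fixed point is the value of each of its greedy policies and dominates the value of every policy
(`Qval_eq_of_isGreedy`, `Qval_le_of_policyBellman_le`). Its strict gaps between actions survive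
small perturbations, which settles the greedy policies. -/

theorem dependsOn_eq_prolong {β : Type*} {n : ℕ} {F : (ℕ → X) → β}
    (hF : DependsOn F (Set.Iic n)) (x : ℕ → X) :
    F (prolong (Preorder.frestrictLe n x)) = F x := by
  refine hF fun i hi => ?_
  simp [prolong, Preorder.frestrictLe, min_eq_left (Set.mem_Iic.1 hi)]

theorem dependsOn_step {β : Type*} {n : ℕ} {F : (ℕ → X) → X → β}
    (hF : DependsOn F (Set.Iic n)) :
    DependsOn (fun ω : ℕ → X => F ω (ω (n + 1))) (Set.Iic (n + 1)) := fun x y h => by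
  simp only
  rw [hF (fun i hi => h i (Set.mem_Iic.2 ((Set.mem_Iic.1 hi).trans n.le_succ))),
    h (n + 1) (Set.mem_Iic.2 le_rfl)]

variable [Fintype X]

/-- There are only finitely many histories up to time n. Boundedness, and with it integrability, is
therefore automatic for every quantity determined by a finite horizon. -/
theorem exists_bound_of_dependsOn {n : ℕ} {F : (ℕ → X) → ℝ}
    (hF : DependsOn F (Set.Iic n)) : ∃ C, ∀ x, |F x| ≤ C := by
  obtain ⟨C, hC⟩ := (Set.finite_range
    (fun h : (i : Finset.Iic n) → X => |F (prolong h)|)).bddAbove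
  refine ⟨C, fun x => ?_⟩
  rw [← dependsOn_eq_prolong hF x]
  exact hC ⟨Preorder.frestrictLe n x, rfl⟩

/-- The mean of `F ω` under the conditional law of the value at time `n + 1`. -/
noncomputable def condMean (next : ℕ → (ℕ → X) → PMF X) (n : ℕ) (F : (ℕ → X) → X → ℝ)
    (ω : ℕ → X) : ℝ :=
  ∑ y, (next n ω y).toReal * F ω y

theorem dependsOn_condMean {n : ℕ} {next : ℕ → (ℕ → X) → PMF X}
    (hnext : DependsOn (next n) (Set.Iic n))
    {F : (ℕ → X) → X → ℝ} (hF : DependsOn F (Set.Iic n)) :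
    DependsOn (condMean next n F) (Set.Iic n) := fun x y h => by
  simp only [condMean, hnext h, hF h]

variable [MeasurableSpace X] [MeasurableSingletonClass X]

theorem measurable_piLE_of_dependsOn {β : Type*} [MeasurableSpace β] {n : ℕ} {F : (ℕ → X) → β}
    (hF : DependsOn F (Set.Iic n)) :
    Measurable[Filtration.piLE (X := fun _ : ℕ => X) n] F := by
  rw [Filtration.piLE_eq_comap_frestrictLe]
  have h : F = (fun h => F (prolong h)) ∘ Preorder.frestrictLe (π := fun _ : ℕ => X) n := by
    funext x; exact (dependsOn_eq_prolong hF x).symm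
  rw [h]
  exact (Measurable.of_discrete (f := fun h : (i : Finset.Iic n) → X => F (prolong h))).comp
    (comap_measurable _)

theorem measurable_of_dependsOn {β : Type*} [MeasurableSpace β] {n : ℕ} {F : (ℕ → X) → β}
    (hF : DependsOn F (Set.Iic n)) : Measurable F :=
  (measurable_piLE_of_dependsOn hF).mono (Filtration.piLE.le n) le_rfl

variable {μ₀ : PMF X} {next : ℕ → (ℕ → X) → PMF X}

instance : IsProbabilityMeasure (pathLaw μ₀ next) := by
  unfold pathLaw
  infer_instance

theorem integrable_of_dependsOn {n : ℕ} {F : (ℕ → X) → ℝ}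
    (hF : DependsOn F (Set.Iic n)) : Integrable F (pathLaw μ₀ next) := by
  obtain ⟨C, hC⟩ := exists_bound_of_dependsOn hF
  exact Integrable.of_bound (measurable_of_dependsOn hF).aestronglyMeasurable C
    (Eventually.of_forall hC)

theorem map_frestrictLe_compProd (n : ℕ) :
    (pathLaw μ₀ next).map (Preorder.frestrictLe n) ⊗ₘ nextKernel next n =
      (pathLaw μ₀ next).map (fun x => (Preorder.frestrictLe n x, x (n + 1))) :=
  Kernel.map_frestrictLe_trajMeasure_compProd_eq_map_trajMeasure

theorem integral_step {n : ℕ} (hnext : DependsOn (next n) (Set.Iic n))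
    {F : (ℕ → X) → X → ℝ} (hF : DependsOn F (Set.Iic n)) :
    ∫ ω, F ω (ω (n + 1)) ∂(pathLaw μ₀ next) = ∫ ω, condMean next n F ω ∂(pathLaw μ₀ next) := by
  have hm := map_frestrictLe_compProd (μ₀ := μ₀) (next := next) n
  set f : ((i : Finset.Iic n) → X) × X → ℝ := fun p => F (prolong p.1) p.2 with hf
  have hmeas : Measurable (fun x : ℕ → X => (Preorder.frestrictLe (π := fun _ => X) n x, x (n + 1))) := by
    fun_prop
  have hprob : IsProbabilityMeasure ((pathLaw μ₀ next).map
      (Preorder.frestrictLe (π := fun _ : ℕ => X) n)) :=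
    Measure.isProbabilityMeasure_map (by fun_prop)
  have h1 : ∫ p, f p ∂((pathLaw μ₀ next).map (fun x => (Preorder.frestrictLe n x, x (n + 1))))
      = ∫ ω, F ω (ω (n + 1)) ∂(pathLaw μ₀ next) := by
    rw [integral_map hmeas.aemeasurable Measurable.of_discrete.aestronglyMeasurable]
    refine integral_congr_ae (Eventually.of_forall fun ω => ?_)
    exact congrFun (dependsOn_eq_prolong hF ω) _
  rw [← h1, ← hm, Measure.integral_compProd .of_finite, integral_map (by fun_prop)
    Measurable.of_discrete.aestronglyMeasurable]
  refine integral_congr_ae (Eventually.of_forall fun ω => ?_)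
  simp only [hf, nextKernel, Kernel.ofFunOfCountable, Kernel.coe_mk, condMean]
  rw [PMF.integral_eq_sum, dependsOn_eq_prolong hnext, dependsOn_eq_prolong hF]
  simp

theorem condExp_step {n : ℕ} (hnext : DependsOn (next n) (Set.Iic n))
    {F : (ℕ → X) → X → ℝ} (hF : DependsOn F (Set.Iic n)) :
    (pathLaw μ₀ next)[fun ω => F ω (ω (n + 1)) | Filtration.piLE (X := fun _ : ℕ => X) n]
      =ᵐ[pathLaw μ₀ next] condMean next n F := by
  classical
  have hc := dependsOn_condMean hnext hF
  refine (ae_eq_condExp_of_forall_setIntegral_eq (Filtration.piLE.le n)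
    (integrable_of_dependsOn (dependsOn_step hF)) (fun s _ _ =>
      (integrable_of_dependsOn hc).integrableOn) (fun s hs _ => ?_)
    (measurable_piLE_of_dependsOn hc).stronglyMeasurable.aestronglyMeasurable).symm
  have hs' := hs
  rw [Filtration.piLE_eq_comap_frestrictLe] at hs'
  obtain ⟨t, -, rfl⟩ := hs'
  have hmeas : MeasurableSet (Preorder.frestrictLe (π := fun _ : ℕ => X) n ⁻¹' t) :=
    Filtration.piLE.le n _ hs
  rw [← integral_indicator hmeas, ← integral_indicator hmeas]
  -- An event known at time n can be absorbed into the integrand as an indicator, which reduces the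
  -- set integrals to `integral_step`.
  set G : (ℕ → X) → X → ℝ := fun ω y =>
    (Preorder.frestrictLe (π := fun _ : ℕ => X) n ⁻¹' t).indicator (fun ω => F ω y) ω with hG
  have hr : ∀ {x y : ℕ → X}, (∀ i ∈ Set.Iic n, x i = y i) →
      Preorder.frestrictLe (π := fun _ : ℕ => X) n x = Preorder.frestrictLe n y := by
    intro x y h; funext i; exact h i (Finset.mem_Iic.1 i.2)
  have hGd : DependsOn G (Set.Iic n) := fun x y h => by
    funext z
    simp only [hG, Set.indicator, Set.mem_preimage, hr h, hF h]
  have h := integral_step (μ₀ := μ₀) hnext hGd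
  refine Eq.trans ?_ (h.symm.trans ?_)
  · refine integral_congr_ae (Eventually.of_forall fun ω => ?_)
    by_cases hω : ω ∈ Preorder.frestrictLe (π := fun _ : ℕ => X) n ⁻¹' t <;>
      simp [hG, condMean, hω]
  · refine integral_congr_ae (Eventually.of_forall fun ω => ?_)
    by_cases hω : ω ∈ Preorder.frestrictLe (π := fun _ : ℕ => X) n ⁻¹' t <;>
      simp [hG, hω]

/-- The conditional Borel-Cantelli lemma for a process with law `pathLaw`. -/
theorem ae_frequently_iff (hnext : ∀ n, DependsOn (next n) (Set.Iic n))
    (p : ℕ → (ℕ → X) → X → Prop) [∀ n ω, DecidablePred (p n ω)]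
    (hp : ∀ n, DependsOn (p n) (Set.Iic n)) :
    ∀ᵐ ω ∂(pathLaw μ₀ next), (∃ᶠ n in atTop, p n ω (ω (n + 1))) ↔
      Tendsto (fun n => ∑ k ∈ Finset.range n,
        condMean next k (fun ω y => if p k ω y then 1 else 0) ω) atTop atTop := by
  -- The library lemma sums the conditional probabilities of the events with index k + 1, so the
  -- indices are shifted by one. The conjunct `0 < n` makes the event with index 0 empty.
  set s : ℕ → Set (ℕ → X) := fun n => {ω | p (n - 1) ω (ω n) ∧ 0 < n} with hs
  have hF : ∀ k, DependsOn (fun (ω : ℕ → X) y => if p k ω y then (1 : ℝ) else 0) (Set.Iic k) :=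
    fun k x y h => funext fun z => if_congr (by rw [hp k h]) rfl rfl
  have hsm : ∀ n, MeasurableSet[Filtration.piLE (X := fun _ : ℕ => X) n] (s n) := by
    rintro (_ | n)
    · simp [hs]
    · have : s (n + 1) = (fun ω : ℕ → X => (if p n ω (ω (n + 1)) then (1 : ℝ) else 0)) ⁻¹' {1} := by
        ext ω; simp [hs]
      rw [this]
      exact measurable_piLE_of_dependsOn (dependsOn_step (hF n)) (measurableSet_singleton _)
  have hce : ∀ k, (pathLaw μ₀ next)[(s (k + 1)).indicator (1 : (ℕ → X) → ℝ) |
      Filtration.piLE (X := fun _ : ℕ => X) k] =ᵐ[pathLaw μ₀ next]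
      condMean next k (fun ω y => if p k ω y then 1 else 0) := fun k => by
    have : (s (k + 1)).indicator (1 : (ℕ → X) → ℝ) =
        fun ω => if p k ω (ω (k + 1)) then (1 : ℝ) else 0 := by
      classical
      funext ω; simp [hs, Set.indicator]
    rw [this]
    exact condExp_step (F := fun ω y => if p k ω y then 1 else 0) (hnext k) (hF k)
  filter_upwards [ae_mem_limsup_atTop_iff (pathLaw μ₀ next) hsm, ae_all_iff.2 hce] with ω h1 h2
  simp only [h2] at h1
  rw [← h1, mem_limsup_iff_frequently_mem]
  have h3 : (∃ᶠ n in atTop, ω ∈ s (n + 1)) ↔ ∃ᶠ n in atTop, ω ∈ s n := by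
    conv_rhs => rw [← map_add_atTop_eq_nat 1]
    exact Iff.rfl
  rw [← h3]
  exact frequently_congr (Eventually.of_forall fun n => by simp [hs])

/-- Conditionally centred increments are orthogonal to the past, so the second moment of the sum is
the expected sum of squares. -/
theorem integral_sum_sq_le (hnext : ∀ n, DependsOn (next n) (Set.Iic n))
    {F : ℕ → (ℕ → X) → X → ℝ} (hF : ∀ n, DependsOn (F n) (Set.Iic n))
    (hmean : ∀ n ω, condMean next n (F n) ω = 0) {C : ℝ}
    (hC : ∀ n ω, ∑ i ∈ Finset.range n, F i ω (ω (i + 1)) ^ 2 ≤ C) (n : ℕ) :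
    ∫ ω, (∑ i ∈ Finset.range n, F i ω (ω (i + 1))) ^ 2 ∂(pathLaw μ₀ next) ≤ C := by
  have hD : ∀ n, DependsOn (fun ω : ℕ → X => ∑ i ∈ Finset.range n, F i ω (ω (i + 1)))
      (Set.Iic n) := fun n x y h => Finset.sum_congr rfl fun i hi =>
    dependsOn_step (hF i) fun j hj => h j (Set.mem_Iic.2 ((Set.mem_Iic.1 hj).trans
      (Finset.mem_range.1 hi)))
  have hD2 : ∀ n, DependsOn (fun ω : ℕ → X => F n ω (ω (n + 1)) ^ 2) (Set.Iic (n + 1)) :=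
    fun n x y h => by
      have := dependsOn_step (hF n) h
      simp only at this ⊢
      rw [this]
  have key : ∀ n, ∫ ω, (∑ i ∈ Finset.range n, F i ω (ω (i + 1))) ^ 2 ∂(pathLaw μ₀ next) =
      ∫ ω, ∑ i ∈ Finset.range n, F i ω (ω (i + 1)) ^ 2 ∂(pathLaw μ₀ next) := by
    intro n
    rw [integral_finsetSum _ fun i _ => integrable_of_dependsOn (hD2 i)]
    induction n with
    | zero => simp
    | succ n ih =>
      rw [Finset.sum_range_succ, ← ih]
      set M : (ℕ → X) → ℝ := fun ω => ∑ i ∈ Finset.range n, F i ω (ω (i + 1)) with hM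
      have hG : DependsOn (fun (ω : ℕ → X) y => M ω * F n ω y) (Set.Iic n) := fun x y h => by
        have h1 : M x = M y := hD n h
        simp only [h1, hF n h]
      have h0 : ∫ ω, M ω * F n ω (ω (n + 1)) ∂(pathLaw μ₀ next) = 0 := by
        rw [integral_step (F := fun ω y => M ω * F n ω y) (hnext n) hG]
        have : ∀ ω, condMean next n (fun ω y => M ω * F n ω y) ω = 0 := fun ω => by
          have := hmean n ω
          simp only [condMean] at this ⊢
          rw [← mul_zero (M ω), ← this, Finset.mul_sum]
          exact Finset.sum_congr rfl fun y _ => by ring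
        simp [this]
      have hM2 : DependsOn (fun ω : ℕ → X => M ω ^ 2) (Set.Iic n) := fun x y h => by
        have h1 : M x = M y := hD n h
        simp only [h1]
      have e : ∀ ω, (∑ i ∈ Finset.range (n + 1), F i ω (ω (i + 1))) ^ 2 =
          M ω ^ 2 + (2 * (M ω * F n ω (ω (n + 1))) + F n ω (ω (n + 1)) ^ 2) := fun ω => by
        rw [Finset.sum_range_succ]; simp only [hM]; ring
      have i2 := (integrable_of_dependsOn (μ₀ := μ₀) (next := next)
        (dependsOn_step hG)).const_mul 2
      have i3 := integrable_of_dependsOn (μ₀ := μ₀) (next := next) (hD2 n)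
      simp only [e]
      have hs1 := integral_add (integrable_of_dependsOn (μ₀ := μ₀) (next := next) hM2)
        (i2.add i3)
      simp only [Pi.add_apply] at hs1
      rw [hs1, integral_add i2 i3, integral_const_mul, h0]
      ring
  rw [key]
  have hi : Integrable (fun ω : ℕ → X => ∑ i ∈ Finset.range n, F i ω (ω (i + 1)) ^ 2)
      (pathLaw μ₀ next) := integrable_finsetSum _ fun i _ => integrable_of_dependsOn (hD2 i)
  calc _ ≤ ∫ _, C ∂(pathLaw μ₀ next) := integral_mono hi (integrable_const _) (hC n)
    _ = C := by simp

/-- A series of conditionally centred terms whose squares have bounded sums converges. -/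
theorem ae_exists_tendsto_sum (hnext : ∀ n, DependsOn (next n) (Set.Iic n))
    {F : ℕ → (ℕ → X) → X → ℝ} (hF : ∀ n, DependsOn (F n) (Set.Iic n))
    (hmean : ∀ n ω, condMean next n (F n) ω = 0) {C : ℝ}
    (hC : ∀ n ω, ∑ i ∈ Finset.range n, F i ω (ω (i + 1)) ^ 2 ≤ C) :
    ∀ᵐ ω ∂(pathLaw μ₀ next), ∃ c, Tendsto
      (fun n => ∑ i ∈ Finset.range n, F i ω (ω (i + 1))) atTop (𝓝 c) := by
  have hD : ∀ n, DependsOn (fun ω : ℕ → X => ∑ i ∈ Finset.range n, F i ω (ω (i + 1)))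
      (Set.Iic n) := fun n x y h => Finset.sum_congr rfl fun i hi =>
    dependsOn_step (hF i) fun j hj => h j (Set.mem_Iic.2 ((Set.mem_Iic.1 hj).trans
      (Finset.mem_range.1 hi)))
  set M : ℕ → (ℕ → X) → ℝ := fun n ω => ∑ i ∈ Finset.range n, F i ω (ω (i + 1)) with hM
  have hmart : Martingale M (Filtration.piLE (X := fun _ : ℕ => X)) (pathLaw μ₀ next) := by
    refine martingale_of_condExp_sub_eq_zero_nat
      (fun n => (measurable_piLE_of_dependsOn (hD n)).stronglyMeasurable)
      (fun n => integrable_of_dependsOn (hD n)) fun n => ?_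
    have : M (n + 1) - M n = fun ω => F n ω (ω (n + 1)) := by
      funext ω; simp [hM, Finset.sum_range_succ]
    rw [this]
    filter_upwards [condExp_step (μ₀ := μ₀) (hnext n) (hF n)] with ω hω
    rw [hω, hmean]; rfl
  refine hmart.submartingale.exists_ae_tendsto_of_bdd (R := (1 + C).toNNReal) fun n => ?_
  rw [eLpNorm_one_eq_lintegral_enorm]
  have hint := integrable_of_dependsOn (μ₀ := μ₀) (next := next) (hD n)
  rw [← ofReal_integral_norm_eq_lintegral_enorm hint]
  refine ENNReal.ofReal_le_ofReal ?_
  have hsq : DependsOn (fun ω : ℕ → X => M n ω ^ 2) (Set.Iic n) := fun x y h => by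
    have h1 : M n x = M n y := hD n h
    simp only [h1]
  have isq := integrable_of_dependsOn (μ₀ := μ₀) (next := next) hsq
  -- The bound |x| ≤ 1 + x² passes from L² to the L¹ bound that martingale convergence requires.
  calc ∫ ω, ‖M n ω‖ ∂(pathLaw μ₀ next) ≤ ∫ ω, (1 + M n ω ^ 2) ∂(pathLaw μ₀ next) := by
        refine integral_mono hint.norm ((integrable_const _).add isq) fun ω => ?_
        simp only [Real.norm_eq_abs]
        nlinarith [sq_abs (M n ω), sq_nonneg (|M n ω| - 1)]
    _ = 1 + ∫ ω, M n ω ^ 2 ∂(pathLaw μ₀ next) := by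
        rw [integral_add (integrable_const _) isq]; simp
    _ ≤ 1 + C := by
        have := integral_sum_sq_le (μ₀ := μ₀) hnext hF hmean hC n
        linarith

end PathLaw

/-! ### Asynchronous stochastic approximation -/

/-- The excess over b is multiplied by at most 1 - a ≤ exp(-a) at each step, hence decays like the
exponential of minus the diverging sum. -/
theorem eventually_le_of_relaxation {x a : ℕ → ℝ} {b ε : ℝ}
    (ha : ∀ n, 0 ≤ a n ∧ a n ≤ 1)
    (hsum : Tendsto (fun n => ∑ i ∈ Finset.range n, a i) atTop atTop)
    (hx : ∀ᶠ n in atTop, x (n + 1) ≤ (1 - a n) * x n + a n * b) (hε : 0 < ε) :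
    ∀ᶠ n in atTop, x n ≤ b + ε := by
  obtain ⟨N, hN⟩ := eventually_atTop.1 hx
  set y : ℝ := max (x N - b) 0 with hy
  have hy0 : 0 ≤ y := le_max_right _ _
  have key : ∀ n, N ≤ n → x n - b ≤
      y * Real.exp (∑ i ∈ Finset.range N, a i - ∑ i ∈ Finset.range n, a i) := by
    intro n hn
    induction n, hn using Nat.le_induction with
    | base => simp [hy]
    | succ n hn ih =>
      have h1 : x (n + 1) - b ≤ (1 - a n) * (x n - b) := by linarith [hN n hn]
      have h2 : (1 - a n) * (x n - b) ≤ (1 - a n) *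
          (y * Real.exp (∑ i ∈ Finset.range N, a i - ∑ i ∈ Finset.range n, a i)) :=
        mul_le_mul_of_nonneg_left ih (by linarith [(ha n).2])
      have h3 : 1 - a n ≤ Real.exp (-a n) := by linarith [Real.add_one_le_exp (-a n)]
      refine h1.trans (h2.trans ((mul_le_mul_of_nonneg_right h3 (by positivity)).trans_eq ?_))
      rw [mul_left_comm, ← Real.exp_add, Finset.sum_range_succ]
      ring_nf
  have hlim : Tendsto (fun n => y * Real.exp (∑ i ∈ Finset.range N, a i -
      ∑ i ∈ Finset.range n, a i)) atTop (𝓝 (y * 0)) := by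
    refine (Real.tendsto_exp_atBot.comp ?_).const_mul y
    exact tendsto_const_nhds.add_atBot (tendsto_neg_atTop_atBot.comp hsum)
  rw [mul_zero] at hlim
  filter_upwards [hlim.eventually (gt_mem_nhds hε), eventually_ge_atTop N] with n h1 h2
  linarith [key n h2]

/-- Asynchronous iteration of a map that contracts towards its fixed point `q`, perturbed by noise
whose weighted sums converge. -/
theorem tendsto_of_async_contraction {S A : Type*} [Finite S] [Finite A]
    {T : (S → A → ℝ) → S → A → ℝ} {q : S → A → ℝ} {γ : ℝ} (hγ0 : 0 < γ) (hγ1 : γ < 1)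
    (hT : ∀ Q d, (∀ s a, |Q s a - q s a| ≤ d) → ∀ s a, |T Q s a - q s a| ≤ γ * d)
    {Q α w : ℕ → S → A → ℝ} (hα : ∀ n s a, 0 ≤ α n s a ∧ α n s a ≤ 1)
    (hsum : ∀ s a, Tendsto (fun n => ∑ i ∈ Finset.range n, α i s a) atTop atTop)
    (hQ : ∀ n s a, Q (n + 1) s a =
      (1 - α n s a) * Q n s a + α n s a * (T (Q n) s a + w n s a))
    (hw : ∀ s a, ∃ c, Tendsto (fun n => ∑ i ∈ Finset.range n, α i s a * w i s a) atTop (𝓝 c))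
    (hbdd : ∃ D, ∀ n s a, |Q n s a| ≤ D) (s : S) (a : A) :
    Tendsto (fun n => Q n s a) atTop (𝓝 (q s a)) := by
  choose c hc using hw
  -- R is minus the tail of the noise series and tends to 0. Subtracting it from Q cancels the noise
  -- term from the recursion, at the price of a small shift of the target.
  set R : ℕ → S → A → ℝ := fun n s a => ∑ i ∈ Finset.range n, α i s a * w i s a - c s a with hR
  have hR0 : ∀ s a, Tendsto (fun n => R n s a) atTop (𝓝 0) := fun s a => by
    simpa using (hc s a).sub_const (c s a)
  have hRs : ∀ ε : ℝ, 0 < ε → ∀ᶠ n in atTop, ∀ s a, |R n s a| ≤ ε := fun ε hε => by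
    refine eventually_all.2 fun s => eventually_all.2 fun a => ?_
    have := (hR0 s a).abs
    rw [abs_zero] at this
    exact (this.eventually (gt_mem_nhds hε)).mono fun n h => h.le
  obtain ⟨D, hD⟩ := hbdd
  obtain ⟨D', hD'⟩ : ∃ D', ∀ s a, |q s a| ≤ D' := by
    obtain ⟨B, hB⟩ := (Set.finite_range (fun p : S × A => |q p.1 p.2|)).bddAbove
    exact ⟨B, fun s a => hB ⟨(s, a), rfl⟩⟩
  have step : ∀ d : ℝ, 0 < d → (∀ᶠ n in atTop, ∀ s a, |Q n s a - q s a| ≤ d) →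
      ∀ᶠ n in atTop, ∀ s a, |Q n s a - q s a| ≤ (1 + γ) / 2 * d := by
    intro d hd hev
    -- Three errors of size ε occur below, and γ d + 3 ε = (1 + γ)/2 · d, so the error bound shrinks
    -- by a fixed factor.
    set ε : ℝ := (1 - γ) * d / 6 with hε
    have hεpos : 0 < ε := by have : 0 < 1 - γ := by linarith
                             positivity
    have hZ : ∀ᶠ n in atTop, ∀ s a, |Q n s a - R n s a - q s a| ≤ γ * d + ε + ε := by
      refine eventually_all.2 fun s => eventually_all.2 fun a => ?_
      refine eventually_le_of_relaxation (x := fun n => |Q n s a - R n s a - q s a|)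
        (a := fun n => α n s a) (fun n => hα n s a) (hsum s a) ?_ hεpos
      filter_upwards [hev, hRs ε hεpos] with n h1 h2
      have e : Q (n + 1) s a - R (n + 1) s a - q s a =
          (1 - α n s a) * (Q n s a - R n s a - q s a) +
            α n s a * ((T (Q n) s a - q s a) - R n s a) := by
        rw [hQ]; simp only [hR, Finset.sum_range_succ]; ring
      rw [e]
      refine (abs_add_le _ _).trans ?_
      rw [abs_mul, abs_mul, abs_of_nonneg (hα n s a).1,
        abs_of_nonneg (by linarith [(hα n s a).2] : 0 ≤ 1 - α n s a)]
      have h3 : |T (Q n) s a - q s a - R n s a| ≤ γ * d + ε :=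
        (abs_sub _ _).trans (add_le_add (hT _ _ h1 s a) (h2 s a))
      have := mul_le_mul_of_nonneg_left h3 (hα n s a).1
      linarith
    filter_upwards [hZ, hRs ε hεpos] with n h1 h2 s a
    have h3 : |Q n s a - q s a| ≤ |Q n s a - R n s a - q s a| + |R n s a| := by
      have := abs_add_le (Q n s a - R n s a - q s a) (R n s a)
      rwa [show Q n s a - R n s a - q s a + R n s a = Q n s a - q s a by ring] at this
    have := h1 s a
    have := h2 s a
    have e : (1 + γ) / 2 * d = γ * d + 3 * ε := by rw [hε]; ring
    rw [e]; linarith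
  set d₀ : ℝ := max (D + D') 1 with hd₀
  have hd₀pos : 0 < d₀ := lt_of_lt_of_le one_pos (le_max_right _ _)
  have hρ : 0 < (1 + γ) / 2 := by linarith
  have hit : ∀ j : ℕ, ∀ᶠ n in atTop, ∀ s a, |Q n s a - q s a| ≤ ((1 + γ) / 2) ^ j * d₀ := by
    intro j
    induction j with
    | zero =>
      refine Eventually.of_forall fun n s a => ?_
      rw [pow_zero, one_mul]
      exact (abs_sub _ _).trans ((add_le_add (hD n s a) (hD' s a)).trans (le_max_left _ _))
    | succ j ih =>
      refine (step _ (by positivity) ih).mono fun n h s a => (h s a).trans_eq ?_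
      ring
  rw [Metric.tendsto_nhds]
  intro ε hε
  have hlim : Tendsto (fun j : ℕ => ((1 + γ) / 2) ^ j * d₀) atTop (𝓝 (0 * d₀)) :=
    (tendsto_pow_atTop_nhds_zero_of_lt_one hρ.le (by linarith)).mul_const d₀
  rw [zero_mul] at hlim
  obtain ⟨j, hj⟩ := (hlim.eventually (gt_mem_nhds hε)).exists
  filter_upwards [hit j] with n hn
  rw [Real.dist_eq]
  exact (hn s a).trans_lt hj

/-! ### Finite sums against probability mass functions -/

namespace PMF

variable {α β : Type*} [Fintype α]

theorem sum_toReal_eq_one (p : PMF α) : ∑ x, (p x).toReal = 1 := by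
  rw [← ENNReal.toReal_sum fun x _ => p.apply_ne_top x, ← tsum_fintype (L := .unconditional _),
    p.tsum_coe, ENNReal.toReal_one]

theorem sum_toReal_mul_le (p : PMF α) {f : α → ℝ} {c : ℝ} (h : ∀ x, p x ≠ 0 → f x ≤ c) :
    ∑ x, (p x).toReal * f x ≤ c := by
  calc ∑ x, (p x).toReal * f x ≤ ∑ x, (p x).toReal * c := by
        refine Finset.sum_le_sum fun x _ => ?_
        by_cases hx : p x = 0
        · simp [hx]
        · exact mul_le_mul_of_nonneg_left (h x hx) ENNReal.toReal_nonneg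
    _ = c := by rw [← Finset.sum_mul, sum_toReal_eq_one, one_mul]

theorem le_sum_toReal_mul (p : PMF α) {f : α → ℝ} {c : ℝ} (h : ∀ x, p x ≠ 0 → c ≤ f x) :
    c ≤ ∑ x, (p x).toReal * f x := by
  have := p.sum_toReal_mul_le (f := fun x => -f x) (c := -c) fun x hx => neg_le_neg (h x hx)
  simp only [mul_neg, Finset.sum_neg_distrib] at this
  linarith

variable [Fintype β]

theorem sum_bind_toReal_mul (p : PMF α) (f : α → PMF β) (φ : β → ℝ) :
    ∑ y, ((p.bind f) y).toReal * φ y = ∑ x, (p x).toReal * ∑ y, (f x y).toReal * φ y := by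
  simp only [PMF.bind_apply, Finset.mul_sum]
  rw [Finset.sum_comm]
  refine Finset.sum_congr rfl fun y _ => ?_
  rw [tsum_fintype, ENNReal.toReal_sum fun x _ =>
    ENNReal.mul_ne_top (p.apply_ne_top x) ((f x).apply_ne_top y), Finset.sum_mul]
  exact Finset.sum_congr rfl fun x _ => by rw [ENNReal.toReal_mul, mul_assoc]

theorem sum_map_toReal_mul (p : PMF α) (f : α → β) (φ : β → ℝ) :
    ∑ y, ((p.map f) y).toReal * φ y = ∑ x, (p x).toReal * φ (f x) := by
  classical
  rw [← PMF.bind_pure_comp, sum_bind_toReal_mul]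
  refine Finset.sum_congr rfl fun x _ => ?_
  congr 1
  rw [Finset.sum_eq_single (f x)]
  · simp
  · intro y _ hy; simp [hy]
  · simp

end PMF

/-! ### The Bellman operators -/

theorem abs_iSup_sub_iSup_le {A : Type*} [Finite A] [Nonempty A] {f g : A → ℝ} {d : ℝ}
    (h : ∀ b, |f b - g b| ≤ d) : |(⨆ b, f b) - ⨆ b, g b| ≤ d := by
  have hf := (Set.finite_range f).bddAbove
  have hg := (Set.finite_range g).bddAbove
  rw [abs_sub_le_iff]
  constructor
  · rw [sub_le_iff_le_add]
    exact ciSup_le fun b => by linarith [(abs_le.1 (h b)).2, le_ciSup hg b]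
  · rw [sub_le_iff_le_add]
    exact ciSup_le fun b => by linarith [(abs_le.1 (h b)).1, le_ciSup hf b]

namespace MDP

variable {S A : Type*} (m : MDP S A) [Fintype S] [Fintype A]

/-- The Bellman optimality operator. -/
noncomputable def bellman (Q : S → A → ℝ) (s : S) (a : A) : ℝ :=
  ∑ s', (m.P s a s').toReal * (m.r s a s' + m.γ * ⨆ b, Q s' b)

/-- The Bellman evaluation operator of a policy. -/
noncomputable def policyBellman (π : S → PMF A) (Q : S → A → ℝ) (s : S) (a : A) : ℝ :=
  ∑ s', (m.P s a s').toReal * (m.r s a s' + m.γ * ∑ b, (π s' b).toReal * Q s' b)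

theorem abs_bellman_sub_le [Nonempty A] {Q Q' : S → A → ℝ} {d : ℝ}
    (h : ∀ s a, |Q s a - Q' s a| ≤ d) (s : S) (a : A) :
    |m.bellman Q s a - m.bellman Q' s a| ≤ m.γ * d := by
  have hb : ∀ s', |m.γ * (⨆ b, Q s' b) - m.γ * ⨆ b, Q' s' b| ≤ m.γ * d := fun s' => by
    rw [← mul_sub, abs_mul, abs_of_pos m.γ_pos]
    exact mul_le_mul_of_nonneg_left (abs_iSup_sub_iSup_le (h s')) m.γ_pos.le
  have e : m.bellman Q s a - m.bellman Q' s a =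
      ∑ s', (m.P s a s').toReal * (m.γ * (⨆ b, Q s' b) - m.γ * ⨆ b, Q' s' b) := by
    simp only [bellman, ← Finset.sum_sub_distrib]
    exact Finset.sum_congr rfl fun _ _ => by ring
  rw [e, abs_le]
  exact ⟨(m.P s a).le_sum_toReal_mul fun s' _ => (abs_le.1 (hb s')).1,
    (m.P s a).sum_toReal_mul_le fun s' _ => (abs_le.1 (hb s')).2⟩

theorem exists_bellman_fixedPoint [Nonempty A] : ∃ Q, m.bellman Q = Q := by
  have h : ContractingWith ⟨m.γ, m.γ_pos.le⟩ m.bellman := by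
    refine ⟨m.γ_lt_one, LipschitzWith.of_dist_le_mul fun Q Q' => ?_⟩
    have hd : ∀ s a, |Q s a - Q' s a| ≤ dist Q Q' := fun s a =>
      (dist_le_pi_dist (Q s) (Q' s) a).trans (dist_le_pi_dist Q Q' s)
    have h0 : (0 : ℝ) ≤ m.γ * dist Q Q' := mul_nonneg m.γ_pos.le dist_nonneg
    exact (dist_pi_le_iff h0).2 fun s => (dist_pi_le_iff h0).2 fun a =>
      m.abs_bellman_sub_le hd s a
  exact ⟨_, h.fixedPoint_isFixedPt⟩

theorem policyBellman_le_bellman (π : S → PMF A) (Q : S → A → ℝ) (s : S) (a : A) :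
    m.policyBellman π Q s a ≤ m.bellman Q s a := by
  refine Finset.sum_le_sum fun s' _ => mul_le_mul_of_nonneg_left ?_ ENNReal.toReal_nonneg
  have := (π s').sum_toReal_mul_le (f := Q s') (c := ⨆ b, Q s' b) fun b _ =>
    le_ciSup (Set.finite_range (Q s')).bddAbove b
  have := mul_le_mul_of_nonneg_left this m.γ_pos.le
  linarith

theorem policyBellman_eq_bellman_of_isGreedy [Nonempty A] {π : S → PMF A} {Q : S → A → ℝ}
    (h : IsGreedy π Q) : m.policyBellman π Q = m.bellman Q := by
  funext s a
  refine le_antisymm (m.policyBellman_le_bellman π Q s a) ?_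
  refine Finset.sum_le_sum fun s' _ => mul_le_mul_of_nonneg_left ?_ ENNReal.toReal_nonneg
  have := (π s').le_sum_toReal_mul (f := Q s') (c := ⨆ b, Q s' b) fun b hb =>
    ciSup_le fun b' => h s' b hb b'
  have := mul_le_mul_of_nonneg_left this m.γ_pos.le
  linarith

end MDP

theorem exists_isGreedy {S A : Type*} [Finite A] [Nonempty A] (Q : S → A → ℝ) :
    ∃ π : S → PMF A, IsGreedy π Q := by
  choose f hf using fun s => Finite.exists_max (Q s)
  refine ⟨fun s => PMF.pure (f s), fun s a ha b => ?_⟩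
  have : a = f s := by
    by_contra h
    exact ha (by simp [h])
  rw [this]; exact hf s b

/-- A policy that is greedy for a table close to `Q` is greedy for `Q`. -/
theorem eventually_isGreedy_of_tendsto {S A ι : Type*} [Finite S] [Finite A] {l : Filter ι}
    {F : ι → S → A → ℝ} {Q : S → A → ℝ} (h : ∀ s a, Tendsto (fun n => F n s a) l (𝓝 (Q s a))) :
    ∀ᶠ n in l, ∀ π : S → PMF A, IsGreedy π (F n) → IsGreedy π Q := by
  have : ∀ᶠ n in l, ∀ s a b, Q s a < Q s b → F n s a < F n s b :=
    eventually_all.2 fun s => eventually_all.2 fun a => eventually_all.2 fun b => by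
      by_cases hlt : Q s a < Q s b
      · exact ((h s a).eventually_lt (h s b) hlt).mono fun n hn _ => hn
      · exact Eventually.of_forall fun n h => absurd h hlt
  filter_upwards [this] with n hn π hπ s a ha b
  by_contra hlt
  exact (hπ s a ha b).not_gt (hn s a b (not_le.1 hlt))

/-! ### Policy evaluation -/

theorem PathLaw.map_eval_zero {X : Type*} [Finite X] [MeasurableSpace X]
    [MeasurableSingletonClass X] (μ₀ : PMF X) (next : ℕ → (ℕ → X) → PMF X) :
    (pathLaw μ₀ next).map (fun x => x 0) = μ₀.toMeasure := by
  have h : (fun x : ℕ → X => x 0) = (fun x : (i : Finset.Iic 0) → X => x ⟨0, by simp⟩) ∘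
      Preorder.frestrictLe (π := fun _ : ℕ => X) 0 := rfl
  rw [h, ← Measure.map_map (by fun_prop) (by fun_prop), pathLaw, Kernel.trajMeasure,
    Measure.map_comp _ _ (by fun_prop), Kernel.traj_map_frestrictLe, Kernel.partialTraj_self,
    Measure.id_comp, Measure.map_map (by fun_prop) (by fun_prop)]
  exact Measure.map_id

namespace MDP

open PathLaw

variable {S A : Type*} (m : MDP S A)

/-- The return of the first `n` transitions, completed by the discounted value `Q` at time `n`. -/
noncomputable def truncReturn (Q : S → A → ℝ) (n : ℕ) (x : ℕ → S × A) : ℝ :=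
  ∑ i ∈ Finset.range n, m.γ ^ i * m.r (x i).1 (x i).2 (x (i + 1)).1 +
    m.γ ^ n * Q (x n).1 (x n).2

theorem dependsOn_truncReturn (Q : S → A → ℝ) (n : ℕ) :
    DependsOn (m.truncReturn Q n) (Set.Iic n) := fun x y h => by
  have h' : ∀ i ≤ n, x i = y i := fun i hi => h i hi
  unfold truncReturn
  rw [h' n le_rfl]
  congr 1
  refine Finset.sum_congr rfl fun i hi => ?_
  rw [h' i (Finset.mem_range.1 hi).le, h' (i + 1) (Finset.mem_range.1 hi)]

variable [Fintype S] [MeasurableSpace S] [MeasurableSingletonClass S]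
  [Fintype A] [MeasurableSpace A] [MeasurableSingletonClass A]

theorem integral_truncReturn_zero (π : S → PMF A) (Q : S → A → ℝ) (s : S) (a : A) :
    ∫ x, m.truncReturn Q 0 x ∂(m.policyLaw π s a) = Q s a := by
  have h := map_eval_zero (PMF.pure (s, a)) (fun n x =>
    (m.P (x n).1 (x n).2).bind (fun s' => (π s').map (fun a' => (s', a'))))
  have h2 : ∫ x, m.truncReturn Q 0 x ∂(m.policyLaw π s a) =
      ∫ p, Q p.1 p.2 ∂((m.policyLaw π s a).map (fun x => x 0)) := by
    rw [integral_map (measurable_pi_apply 0).aemeasurable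
      Measurable.of_discrete.aestronglyMeasurable]
    simp [truncReturn]
  rw [h2, policyLaw, h, PMF.toMeasure_pure, integral_dirac]

/-- Replacing the terminal value by one more reward and the next terminal value changes the
conditional mean by the discounted Bellman residual. Values are thereby compared with any table Q
without a Bellman equation for `Qval` itself. -/
theorem integral_truncReturn_succ (π : S → PMF A) (Q : S → A → ℝ) (s : S) (a : A) (n : ℕ) :
    ∫ x, m.truncReturn Q (n + 1) x ∂(m.policyLaw π s a) =
      ∫ x, m.truncReturn Q n x ∂(m.policyLaw π s a) +
      ∫ x, m.γ ^ n * (m.policyBellman π Q (x n).1 (x n).2 - Q (x n).1 (x n).2)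
        ∂(m.policyLaw π s a) := by
  set next : ℕ → (ℕ → S × A) → PMF (S × A) := fun n x =>
    (m.P (x n).1 (x n).2).bind (fun s' => (π s').map (fun a' => (s', a'))) with hnext
  have hn : DependsOn (next n) (Set.Iic n) := fun x y h => by
    simp only [hnext, h n (Set.mem_Iic.2 le_rfl)]
  set F : (ℕ → S × A) → S × A → ℝ := fun x y =>
    m.γ ^ n * (m.r (x n).1 (x n).2 y.1 + m.γ * Q y.1 y.2 - Q (x n).1 (x n).2) with hF
  have hFd : DependsOn F (Set.Iic n) := fun x y h => by
    simp only [hF, h n (Set.mem_Iic.2 le_rfl)]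
  have hc : ∀ x, condMean next n F x =
      m.γ ^ n * (m.policyBellman π Q (x n).1 (x n).2 - Q (x n).1 (x n).2) := fun x => by
    have h1 := (m.P (x n).1 (x n).2).sum_toReal_eq_one
    simp only [condMean, hnext]
    rw [PMF.sum_bind_toReal_mul]
    simp only [PMF.sum_map_toReal_mul, hF, policyBellman]
    have h2 : ∀ s', ∑ b, (π s' b).toReal * (m.γ ^ n * (m.r (x n).1 (x n).2 s' +
        m.γ * Q s' b - Q (x n).1 (x n).2)) = m.γ ^ n * (m.r (x n).1 (x n).2 s' +
        m.γ * ∑ b, (π s' b).toReal * Q s' b) - m.γ ^ n * Q (x n).1 (x n).2 := fun s' => by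
      have h3 := (π s').sum_toReal_eq_one
      have : ∀ b, (π s' b).toReal * (m.γ ^ n * (m.r (x n).1 (x n).2 s' +
        m.γ * Q s' b - Q (x n).1 (x n).2)) = (π s' b).toReal * (m.γ ^ n * (m.r (x n).1 (x n).2 s'
        - Q (x n).1 (x n).2)) + m.γ ^ n * m.γ * ((π s' b).toReal * Q s' b) := fun b => by ring
      simp only [this, Finset.sum_add_distrib]
      rw [← Finset.sum_mul, h3, ← Finset.mul_sum]
      ring
    simp only [h2]
    simp only [mul_sub, Finset.sum_sub_distrib]
    rw [← Finset.sum_mul, h1, one_mul, Finset.mul_sum]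
    congr 1
    exact Finset.sum_congr rfl fun _ _ => by ring
  have hi := integral_step (μ₀ := PMF.pure (s, a)) (F := F) hn hFd
  simp only [hc] at hi
  rw [policyLaw, ← hi, ← integral_add (integrable_of_dependsOn (m.dependsOn_truncReturn Q n))
    (integrable_of_dependsOn (dependsOn_step hFd))]
  refine integral_congr_ae (Eventually.of_forall fun x => ?_)
  simp only [truncReturn, hF, Finset.sum_range_succ]
  ring

theorem tendsto_integral_truncReturn (π : S → PMF A) (Q : S → A → ℝ) (s : S) (a : A) :
    Tendsto (fun n => ∫ x, m.truncReturn Q n x ∂(m.policyLaw π s a)) atTop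
      (𝓝 (m.Qval π s a)) := by
  have hγ0 := m.γ_pos.le
  have hγ1 := m.γ_lt_one
  obtain ⟨R, hR⟩ := (Set.finite_range (fun p : S × A × S => |m.r p.1 p.2.1 p.2.2|)).bddAbove
  have hR : ∀ s a s', |m.r s a s'| ≤ R := fun s a s' => hR ⟨(s, a, s'), rfl⟩
  obtain ⟨B, hB⟩ := (Set.finite_range (fun p : S × A => |Q p.1 p.2|)).bddAbove
  have hB : ∀ s a, |Q s a| ≤ B := fun s a => hB ⟨(s, a), rfl⟩
  have hR0 : 0 ≤ R := (abs_nonneg _).trans (hR s a s)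
  have hB0 : 0 ≤ B := (abs_nonneg _).trans (hB s a)
  have hterm : ∀ (x : ℕ → S × A) i, ‖m.γ ^ i * m.r (x i).1 (x i).2 (x (i + 1)).1‖ ≤
      m.γ ^ i * R := fun x i => by
    rw [norm_mul, norm_pow, Real.norm_of_nonneg hγ0]
    exact mul_le_mul_of_nonneg_left (hR _ _ _) (pow_nonneg hγ0 i)
  have hgeo : Summable (fun i : ℕ => m.γ ^ i * R) :=
    (summable_geometric_of_lt_one hγ0 hγ1).mul_right R
  have : IsProbabilityMeasure (m.policyLaw π s a) := by unfold policyLaw; infer_instance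
  refine tendsto_integral_of_dominated_convergence (fun _ => ∑' i : ℕ, m.γ ^ i * R + B)
    (fun n => (measurable_of_dependsOn (m.dependsOn_truncReturn Q n)).aestronglyMeasurable)
    (integrable_const _) (fun n => Eventually.of_forall fun x => ?_)
    (Eventually.of_forall fun x => ?_)
  · refine (norm_add_le _ _).trans (add_le_add ?_ ?_)
    · refine (norm_sum_le_of_le _ fun i _ => hterm x i).trans ?_
      exact hgeo.sum_le_tsum _ fun i _ => by positivity
    · rw [norm_mul, norm_pow, Real.norm_of_nonneg hγ0]
      calc _ ≤ 1 * B := mul_le_mul (pow_le_one₀ hγ0 hγ1.le) (hB _ _) (abs_nonneg _) zero_le_one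
        _ = B := one_mul B
  · have h1 := (Summable.of_norm_bounded hgeo (hterm x)).hasSum.tendsto_sum_nat
    have h2 : Tendsto (fun n => m.γ ^ n * Q (x n).1 (x n).2) atTop (𝓝 0) := by
      refine squeeze_zero_norm (a := fun n => m.γ ^ n * B) (fun n => ?_) ?_
      · rw [norm_mul, norm_pow, Real.norm_of_nonneg hγ0]
        exact mul_le_mul_of_nonneg_left (hB _ _) (pow_nonneg hγ0 n)
      · simpa using (tendsto_pow_atTop_nhds_zero_of_lt_one hγ0 hγ1).mul_const B
    simpa [truncReturn] using h1.add h2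

theorem Qval_eq_of_policyBellman_eq {π : S → PMF A} {Q : S → A → ℝ}
    (h : m.policyBellman π Q = Q) (s : S) (a : A) : m.Qval π s a = Q s a := by
  have hconst : ∀ n, ∫ x, m.truncReturn Q n x ∂(m.policyLaw π s a) = Q s a := fun n => by
    induction n with
    | zero => exact m.integral_truncReturn_zero π Q s a
    | succ n ih => rw [integral_truncReturn_succ, ih, h]; simp
  have hlim := m.tendsto_integral_truncReturn π Q s a
  simp only [hconst] at hlim
  exact tendsto_nhds_unique hlim tendsto_const_nhds

theorem Qval_le_of_policyBellman_le {π : S → PMF A} {Q : S → A → ℝ}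
    (h : ∀ s a, m.policyBellman π Q s a ≤ Q s a) (s : S) (a : A) : m.Qval π s a ≤ Q s a := by
  have hle : ∀ n, ∫ x, m.truncReturn Q n x ∂(m.policyLaw π s a) ≤ Q s a := fun n => by
    induction n with
    | zero => exact (m.integral_truncReturn_zero π Q s a).le
    | succ n ih =>
      rw [integral_truncReturn_succ]
      have : ∫ x, m.γ ^ n * (m.policyBellman π Q (x n).1 (x n).2 - Q (x n).1 (x n).2)
          ∂(m.policyLaw π s a) ≤ 0 := integral_nonpos fun x =>
        mul_nonpos_of_nonneg_of_nonpos (pow_nonneg m.γ_pos.le n) (sub_nonpos.2 (h _ _))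
      linarith
  exact le_of_tendsto (m.tendsto_integral_truncReturn π Q s a) (Eventually.of_forall hle)

variable [Nonempty A]

theorem Qval_eq_of_isGreedy {π : S → PMF A} {Q : S → A → ℝ} (hQ : m.bellman Q = Q)
    (h : IsGreedy π Q) (s : S) (a : A) : m.Qval π s a = Q s a :=
  m.Qval_eq_of_policyBellman_eq ((m.policyBellman_eq_bellman_of_isGreedy h).trans hQ) s a

theorem isOptimal_of_isGreedy {π : S → PMF A} {Q : S → A → ℝ} (hQ : m.bellman Q = Q)
    (h : IsGreedy π Q) : m.IsOptimal π := fun π' s a => by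
  rw [m.Qval_eq_of_isGreedy hQ h]
  exact m.Qval_le_of_policyBellman_le (fun s a =>
    (m.policyBellman_le_bellman π' Q s a).trans_eq (congrFun (congrFun hQ s) a)) s a

end MDP

/-! ### Boltzmann exploration with tables of positive variance -/

theorem ciSup_add_le_ciSup {A : Type*} [Finite A] [Nonempty A] {f g : A → ℝ} {d : ℝ}
    (h : ∀ b, g b + d ≤ f b) : (⨆ b, g b) + d ≤ ⨆ b, f b := by
  rw [← le_sub_iff_add_le]
  exact ciSup_le fun b => by linarith [h b, le_ciSup (Set.finite_range f).bddAbove b]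

theorem one_le_truncBelow_logb {α : ℝ} (h0 : 0 < α) (h1 : α ≤ 1 / 4) (x : ℝ) :
    1 ≤ Real.logb (1 / α) (truncBelow (1 / α) x) := by
  have h4 : (4 : ℝ) ≤ 1 / α := by rw [le_div_iff₀ h0]; linarith
  have : 1 / α ≤ truncBelow (1 / α) x := by unfold truncBelow; split_ifs with h <;> linarith
  rw [Real.le_logb_iff_rpow_le (by linarith) (by linarith), Real.rpow_one]
  exact this

/-- This is where α ≤ 1/4 is needed: the base 1/α is at least 4, so a factor 4 per visit costs at
most 1 in the logarithm. -/
theorem logb_truncBelow_le {α : ℝ} (h0 : 0 < α) (h1 : α ≤ 1 / 4) {x C : ℝ} (hC : 0 < C) {v : ℕ}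
    (hx : x ≤ C * 4 ^ v) :
    Real.logb (1 / α) (truncBelow (1 / α) x) ≤ Real.logb (1 / α) (1 / α + C) + v := by
  have h4 : (4 : ℝ) ≤ 1 / α := by rw [le_div_iff₀ h0]; linarith
  have hb : 1 < 1 / α := by linarith
  have hpow : (1 : ℝ) ≤ (1 / α) ^ v := one_le_pow₀ hb.le
  have hle : truncBelow (1 / α) x ≤ (1 / α + C) * (1 / α) ^ v := by
    have hx' : x ≤ C * (1 / α) ^ v :=
      hx.trans (mul_le_mul_of_nonneg_left (pow_le_pow_left₀ (by norm_num) h4 v) hC.le)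
    have : 1 / α ≤ 1 / α * (1 / α) ^ v := le_mul_of_one_le_right (by linarith) hpow
    have : 0 < C * (1 / α) ^ v := by positivity
    unfold truncBelow
    split_ifs <;> linarith
  have hpos : 0 < truncBelow (1 / α) x := by unfold truncBelow; split_ifs <;> linarith
  refine (Real.logb_le_logb_of_le hb hpos hle).trans_eq ?_
  rw [Real.logb_mul (by positivity) (by positivity), Real.logb_pow, Real.logb_self_eq_one hb,
    mul_one]

/-- Boltzmann probabilities are bounded below when the parameter times the spread is. -/
theorem one_div_card_mul_le_boltzmann {A : Type*} [Fintype A] {x : A → ℝ} {β L : ℝ} (hL : 0 < L)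
    (h : ∀ a b, β * (x b - x a) ≤ Real.log L) (a : A) :
    1 / (Fintype.card A * L) ≤ Real.exp (β * x a) / ∑ b, Real.exp (β * x b) := by
  have : Nonempty A := ⟨a⟩
  have hsum : ∑ b, Real.exp (β * x b) ≤ Fintype.card A * L * Real.exp (β * x a) := by
    have : ∀ b ∈ Finset.univ, Real.exp (β * x b) ≤ L * Real.exp (β * x a) := fun b _ => by
      calc Real.exp (β * x b) ≤ Real.exp (Real.log L + β * x a) :=
            Real.exp_le_exp.2 (by linarith [h a b])
        _ = L * Real.exp (β * x a) := by rw [Real.exp_add, Real.exp_log hL]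
    refine (Finset.sum_le_card_nsmul _ _ _ this).trans_eq ?_
    rw [nsmul_eq_mul, Finset.card_univ, mul_assoc]
  have hpos : 0 < ∑ b, Real.exp (β * x b) :=
    Finset.sum_pos (fun b _ => Real.exp_pos _) Finset.univ_nonempty
  have hc : (0 : ℝ) < Fintype.card A := by exact_mod_cast Fintype.card_pos
  rw [div_le_div_iff₀ (by positivity) hpos]
  linarith

/-! ### Counting visits and reindexing sums by visits -/

theorem visits_succ {S A : Type*} (st : ℕ → S) (ac : ℕ → A) (n : ℕ) (s : S) (a : A)
    [Decidable (st n = s ∧ ac n = a)] :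
    visits st ac (n + 1) s a = visits st ac n s a + if st n = s ∧ ac n = a then 1 else 0 := by
  unfold visits
  rw [Finset.range_add_one, Finset.filter_insert]
  split_ifs with h
  · rw [Finset.card_insert_of_notMem (by simp)]
  · rfl

theorem visits_congr {S A : Type*} {st st' : ℕ → S} {ac ac' : ℕ → A} {n : ℕ}
    (hst : ∀ i < n, st i = st' i) (hac : ∀ i < n, ac i = ac' i) (s : S) (a : A) :
    visits st ac n s a = visits st' ac' n s a := by
  classical
  induction n with
  | zero => simp [visits]
  | succ n ih =>
    rw [visits_succ, visits_succ, ih (fun i hi => hst i (by omega)) (fun i hi => hac i (by omega)),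
      hst n (by omega), hac n (by omega)]

open Classical in
theorem sum_visits {S A : Type*} [Fintype A] (st : ℕ → S) (ac : ℕ → A) (n : ℕ) (s : S) :
    ∑ a, visits st ac n s a = Nat.count (fun i => st i = s) n := by
  induction n with
  | zero => simp [visits]
  | succ n ih =>
    simp only [visits_succ, Finset.sum_add_distrib, ih, Nat.count_succ]
    congr 1
    by_cases h : st n = s <;> simp [h]

/-- At the times where p holds, the running count takes the values 0, 1, 2, … once each. -/
theorem sum_ite_count (p : ℕ → Prop) [DecidablePred p] (f : ℕ → ℝ) (n : ℕ) :
    ∑ i ∈ Finset.range n, (if p i then f (Nat.count p i) else 0) =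
      ∑ j ∈ Finset.range (Nat.count p n), f j := by
  induction n with
  | zero => simp
  | succ n ih =>
    rw [Finset.sum_range_succ, ih, Nat.count_succ]
    split_ifs <;> simp [Finset.sum_range_succ]

theorem tendsto_count_atTop {p : ℕ → Prop} [DecidablePred p] (h : ∃ᶠ n in atTop, p n) :
    Tendsto (Nat.count p) atTop atTop := by
  refine tendsto_atTop_atTop_of_monotone (Nat.count_monotone p) fun b => ?_
  induction b with
  | zero => exact ⟨0, Nat.zero_le _⟩
  | succ b ih =>
    obtain ⟨N, hN⟩ := ih
    obtain ⟨n, hn, hv⟩ := (frequently_atTop.1 h) N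
    refine ⟨n + 1, ?_⟩
    rw [Nat.count_succ, if_pos hv]
    have := Nat.count_monotone p hn
    omega

theorem tendsto_sum_ite_count_atTop {p : ℕ → Prop} [DecidablePred p] (h : ∃ᶠ n in atTop, p n)
    {f : ℕ → ℝ} (hf : Tendsto (fun n => ∑ j ∈ Finset.range n, f j) atTop atTop) :
    Tendsto (fun n => ∑ i ∈ Finset.range n, (if p i then f (Nat.count p i) else 0))
      atTop atTop := by
  simp only [sum_ite_count]
  exact hf.comp (tendsto_count_atTop h)

open Classical in
theorem visits_eq_count {S A : Type*} (st : ℕ → S) (ac : ℕ → A) (n : ℕ) (s : S) (a : A) :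
    visits st ac n s a = Nat.count (fun i => st i = s ∧ ac i = a) n := by
  rw [Nat.count_eq_card_filter_range]; rfl

namespace GEA

variable {K : ℕ} {S A : Type*} (g : GEA K S A)

/-! ### Dependence of the algorithm on the past only -/

section Congr

variable {st st' : ℕ → Fin K → S} {ac ac' : ℕ → Fin K → A} {n : ℕ}

theorem Qhat_congr (k : Fin K) (q : S → A → ℝ) {st st' : ℕ → S} {ac ac' : ℕ → A}
    (hst : ∀ i ≤ n, st i = st' i) (hac : ∀ i < n, ac i = ac' i) :
    g.Qhat k q st ac n = g.Qhat k q st' ac' n := by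
  induction n with
  | zero => rfl
  | succ n ih =>
    funext s a
    simp only [Qhat]
    rw [ih (fun i hi => hst i (by omega)) (fun i hi => hac i (by omega)), hst n (by omega),
      hac n (by omega), hst (n + 1) le_rfl,
      visits_congr (fun i hi => hst i (by omega)) (fun i hi => hac i (by omega))]

variable (q₀ : Fin K → S → A → ℝ)

theorem sigmaSq_congr (hst : ∀ i ≤ n, st i = st' i) (hac : ∀ i < n, ac i = ac' i) :
    g.sigmaSq q₀ st ac n = g.sigmaSq q₀ st' ac' n := by
  funext k s a
  unfold sigmaSq
  congr 1
  funext l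
  rw [g.Qhat_congr l (q₀ l) (fun i hi => congrFun (hst i hi) l) fun i hi => congrFun (hac i hi) l]

theorem Qtilde_congr (hst : ∀ i ≤ n, st i = st' i) (hac : ∀ i < n, ac i = ac' i) :
    g.Qtilde q₀ st ac n = g.Qtilde q₀ st' ac' n := by
  funext k s a
  unfold Qtilde
  rw [g.sigmaSq_congr q₀ hst hac,
    g.Qhat_congr k (q₀ k) (fun i hi => congrFun (hst i hi) k) fun i hi => congrFun (hac i hi) k]

theorem behav_congr [Fintype S] [Fintype A] [Nonempty A]
    (hst : ∀ i ≤ n, st i = st' i) (hac : ∀ i < n, ac i = ac' i) :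
    g.behav q₀ st ac n = g.behav q₀ st' ac' n := by
  have h : g.beta q₀ st ac n = g.beta q₀ st' ac' n := by
    funext k s
    unfold beta spread expSigmaSq
    rw [g.Qtilde_congr q₀ hst hac]
    simp only [g.sigmaSq_congr _ hst hac]
  funext k s
  unfold behav
  simp only [h, g.Qtilde_congr q₀ hst hac]

end Congr

/-! ### Influence of the initial tables -/

variable (k : Fin K) (st : ℕ → S) (ac : ℕ → A)

/-- A lower bound for the rate at which the Q-values of agent `k` at time `n` grow with a uniform
increase of its initial table. -/
noncomputable def influence : ℕ → S → A → ℝ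
  | 0 => fun _ _ => 1
  | n + 1 => fun s a => by
      classical
      exact
        if st n = s ∧ ac n = a then
          (1 - g.step k s a (visits st ac n s a)) * influence n s a +
            g.step k s a (visits st ac n s a) * g.mdp.γ ^ (n + 1)
        else influence n s a

variable {st ac}

theorem influence_congr {st' : ℕ → S} {ac' : ℕ → A} {n : ℕ}
    (hst : ∀ i < n, st i = st' i) (hac : ∀ i < n, ac i = ac' i) :
    g.influence k st ac n = g.influence k st' ac' n := by
  induction n with
  | zero => rfl
  | succ n ih =>
    funext s a
    simp only [influence]
    rw [ih (fun i hi => hst i (by omega)) (fun i hi => hac i (by omega)), hst n (by omega),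
      hac n (by omega),
      visits_congr (fun i hi => hst i (by omega)) (fun i hi => hac i (by omega))]

variable (st ac)

/-- A visit averages a value of at least γ^n with γ^(n+1). The bound is crude, but it provides
positivity and controls every entry of the successor state at once. -/
theorem pow_le_influence (hstep : ∀ k s a i, 0 ≤ g.step k s a i ∧ g.step k s a i ≤ 1)
    (n : ℕ) (s : S) (a : A) : g.mdp.γ ^ n ≤ g.influence k st ac n s a := by
  have h0 := g.mdp.γ_pos.le
  have h1 := g.mdp.γ_lt_one.le
  induction n with
  | zero => simp [influence]
  | succ n ih =>
    have hle : g.mdp.γ ^ (n + 1) ≤ g.mdp.γ ^ n := pow_le_pow_of_le_one h0 h1 n.le_succ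
    simp only [influence]
    split_ifs
    · obtain ⟨h2, h3⟩ := hstep k s a (visits st ac n s a)
      have := mul_le_mul_of_nonneg_left (hle.trans ih) (sub_nonneg.2 h3)
      linarith
    · exact hle.trans ih

theorem mul_influence_le_Qhat_sub [Finite A] [Nonempty A]
    (hstep : ∀ k s a i, 0 ≤ g.step k s a i ∧ g.step k s a i ≤ 1) {δ : ℝ} (hδ : 0 ≤ δ)
    {q q' : S → A → ℝ} (hq : ∀ s a, q' s a + δ ≤ q s a) (n : ℕ) (s : S) (a : A) :
    g.Qhat k q' st ac n s a + δ * g.influence k st ac n s a ≤ g.Qhat k q st ac n s a := by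
  induction n generalizing s a with
  | zero => simpa [influence, Qhat] using hq s a
  | succ n ih =>
    simp only [influence, Qhat]
    split_ifs
    · obtain ⟨h2, h3⟩ := hstep k s a (visits st ac n s a)
      set α := g.step k s a (visits st ac n s a)
      -- All entries at the next state rise by at least δ γ^n, hence so does their maximum;
      -- discounting gives the γ^(n+1) in `influence`.
      have h4 : (⨆ b, g.Qhat k q' st ac n (st (n + 1)) b) + δ * g.mdp.γ ^ n ≤
          ⨆ b, g.Qhat k q st ac n (st (n + 1)) b := ciSup_add_le_ciSup fun b => by
        have := mul_le_mul_of_nonneg_left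
          (g.pow_le_influence k st ac hstep n (st (n + 1)) b) hδ
        linarith [ih (st (n + 1)) b]
      have h5 := mul_le_mul_of_nonneg_left (mul_le_mul_of_nonneg_left h4 g.mdp.γ_pos.le) h2
      have h6 := mul_le_mul_of_nonneg_left (ih s a) (sub_nonneg.2 h3)
      rw [pow_succ]
      linarith
    · exact ih s a

theorem exists_influence_ge (hstep : ∀ k s a i, 0 ≤ g.step k s a i ∧ g.step k s a i ≤ 1)
    (hlim : ∀ k s a, Tendsto (g.step k s a) atTop (𝓝 0)) (s : S) (a : A) :
    ∃ κ > 0, ∀ᶠ n in atTop, κ ≤ g.influence k st ac n s a * 2 ^ visits st ac n s a := by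
  classical
  have hsmall : ∀ᶠ i in atTop, g.step k s a i ≤ 1 / 2 :=
    ((hlim k s a).eventually (gt_mem_nhds (by norm_num : (0 : ℝ) < 1 / 2))).mono fun _ h => h.le
  have hev : ∀ᶠ n in atTop, st n = s ∧ ac n = a → g.step k s a (visits st ac n s a) ≤ 1 / 2 := by
    by_cases hfr : ∃ᶠ n in atTop, st n = s ∧ ac n = a
    · refine ((tendsto_count_atTop hfr).eventually hsmall).mono fun n h _ => ?_
      rwa [visits_eq_count]
    -- A pair visited finitely often satisfies the condition vacuously from some time on.
    · exact (not_frequently.1 hfr).mono fun n h h' => absurd h' h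
  obtain ⟨N, hN⟩ := eventually_atTop.1 hev
  have hpos : ∀ n, 0 < g.influence k st ac n s a := fun n =>
    (pow_pos g.mdp.γ_pos n).trans_le (g.pow_le_influence k st ac hstep n s a)
  refine ⟨g.influence k st ac N s a * 2 ^ visits st ac N s a, by have := hpos N; positivity,
    eventually_atTop.2 ⟨N, fun n hn => ?_⟩⟩
  induction n, hn using Nat.le_induction with
  | base => exact le_rfl
  | succ n hn ih =>
    refine ih.trans ?_
    rw [visits_succ]
    by_cases hv : st n = s ∧ ac n = a
    · simp only [influence, if_pos hv]
      have h1 := hN n hn hv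
      have h2 := mul_nonneg (hstep k s a (visits st ac n s a)).1 (pow_nonneg g.mdp.γ_pos.le (n + 1))
      have h3 : g.influence k st ac n s a ≤ 2 * ((1 - g.step k s a (visits st ac n s a)) *
          g.influence k st ac n s a + g.step k s a (visits st ac n s a) * g.mdp.γ ^ (n + 1)) := by
        nlinarith [hpos n]
      have h4 := mul_le_mul_of_nonneg_right h3 (pow_nonneg (zero_le_two : (0 : ℝ) ≤ 2)
        (visits st ac n s a))
      rw [pow_succ (2 : ℝ)]
      linarith
    · simp [influence, if_neg hv]

/-! ### The expected sample variance -/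

/-- Two of the squared deviations already control the squared difference, by (u - v)² ≤ 2(u² + v²).
-/
theorem sq_sub_le_mul_sampleVar {l : Fin K} (hk : k ∈ g.nbhd k) (hl : l ∈ g.nbhd k)
    (hlk : k ≠ l) (x : Fin K → ℝ) :
    (2 * (((g.nbhd k).card : ℝ) - 1))⁻¹ * (x k - x l) ^ 2 ≤ g.sampleVar k x := by
  have hcard : 1 < (g.nbhd k).card := Finset.one_lt_card.2 ⟨k, hk, l, hl, hlk⟩
  have hc : (0 : ℝ) < ((g.nbhd k).card : ℝ) - 1 := by
    have : (1 : ℝ) < (g.nbhd k).card := by exact_mod_cast hcard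
    linarith
  have hpair : (x k - g.sampleMean k x) ^ 2 + (x l - g.sampleMean k x) ^ 2 ≤
      ∑ i ∈ g.nbhd k, (x i - g.sampleMean k x) ^ 2 := by
    rw [← Finset.sum_pair (f := fun i => (x i - g.sampleMean k x) ^ 2) hlk]
    exact Finset.sum_le_sum_of_subset_of_nonneg
      (by intro i hi; rcases Finset.mem_insert.1 hi with rfl | h
          · exact hk
          · rwa [Finset.mem_singleton.1 h]) fun _ _ _ => sq_nonneg _
  have h2 : (x k - x l) ^ 2 ≤ 2 * ∑ i ∈ g.nbhd k, (x i - g.sampleMean k x) ^ 2 := by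
    nlinarith [sq_nonneg (x k - g.sampleMean k x + (x l - g.sampleMean k x))]
  have h3 := mul_le_mul_of_nonneg_left h2 (inv_nonneg.2 (by positivity :
    0 ≤ 2 * (((g.nbhd k).card : ℝ) - 1)))
  refine h3.trans_eq ?_
  unfold sampleVar
  field_simp

theorem sampleVar_nonneg (hk : k ∈ g.nbhd k) (x : Fin K → ℝ) : 0 ≤ g.sampleVar k x := by
  have : (1 : ℝ) ≤ (g.nbhd k).card := by exact_mod_cast Finset.card_pos.2 ⟨k, hk⟩
  exact mul_nonneg (one_div_nonneg.2 (by linarith)) (Finset.sum_nonneg fun _ _ => sq_nonneg _)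

/-- A centred law with no mass on one side of 0 is concentrated at 0. Continuity of measure then
moves the positive mass away from 0. -/
theorem exists_pos_mass_of_variance_ne_zero {M : Measure ℝ} [IsProbabilityMeasure M]
    (hbdd : ∃ B : ℝ, ∀ᵐ x ∂M, |x| ≤ B) (hmean : ∫ x, x ∂M = 0) (hvar : variance id M ≠ 0) :
    ∃ δ > 0, 0 < M (Set.Ici δ) ∧ 0 < M (Set.Iic 0) := by
  obtain ⟨B, hB⟩ := hbdd
  have hint : Integrable (fun x : ℝ => x) M :=
    Integrable.of_bound measurable_id.aestronglyMeasurable B hB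
  have hzero : ¬ (fun x : ℝ => x) =ᵐ[M] 0 := fun h => hvar (by
    rw [variance_eq_integral measurable_id.aemeasurable]
    simp only [id, hmean, sub_zero]
    rw [integral_congr_ae (g := fun _ => (0 : ℝ))]
    · simp
    · exact h.mono fun x hx => by simp only [Pi.zero_apply] at hx; simp [hx])
  have hpos : M (Set.Ioi 0) ≠ 0 := fun h => hzero (by
    have hle : ∀ᵐ x ∂M, 0 ≤ -x := by
      refine measure_mono_null (fun x hx => ?_) h
      simpa using hx
    have := (integral_eq_zero_iff_of_nonneg_ae hle hint.neg).1 (by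
      rw [integral_neg, hmean, neg_zero])
    exact this.mono fun x hx => by simpa using hx)
  have hneg : 0 < M (Set.Iic 0) := by
    refine pos_iff_ne_zero.2 fun h => hzero ?_
    have hle : ∀ᵐ x ∂M, 0 ≤ x := by
      refine measure_mono_null (fun x hx => ?_) h
      exact (not_le.1 (by simpa using hx : ¬ (0 ≤ x))).le
    exact (integral_eq_zero_iff_of_nonneg_ae hle hint).1 hmean
  obtain ⟨n, hn⟩ : ∃ n : ℕ, M (Set.Ici (1 / ((n : ℝ) + 1))) ≠ 0 := by
    by_contra! h
    refine hpos (measure_mono_null (fun x hx => ?_) (measure_iUnion_null h))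
    obtain ⟨n, hn⟩ := exists_nat_one_div_lt (Set.mem_Ioi.1 hx)
    exact Set.mem_iUnion.2 ⟨n, hn.le⟩
  exact ⟨_, by positivity, pos_iff_ne_zero.2 hn, hneg⟩

/-- The table of agent k lies in U (entries ≥ δ) or in D (entries ≤ 0) with positive probability,
and its value at (s, a) differs between the two by at least δ times the influence. The independent
value of a neighbour l lies on one given side of the midpoint with probability at least 1/2, and U
or D puts agent k on the other side. The constant does not depend on the history. -/
theorem exists_mul_influence_sq_le_expSigmaSq [Fintype S] [Fintype A] [Nonempty A]
    (hstep : ∀ k s a i, 0 ≤ g.step k s a i ∧ g.step k s a i ≤ 1)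
    (hself : ∀ k, g.graph.Adj k k) [IsProbabilityMeasure g.M]
    (hbdd : ∃ B : ℝ, ∀ᵐ x ∂g.M, |x| ≤ B) (hmean : ∫ x, x ∂g.M = 0)
    (hvar : variance id g.M ≠ 0) :
    ∃ c > 0, ∀ (st : ℕ → Fin K → S) (ac : ℕ → Fin K → A) n s a,
      g.expSigmaSq st ac n k s a = 0 ∨
      c * g.influence k (fun i => st i k) (fun i => ac i k) n s a ^ 2 ≤
        g.expSigmaSq st ac n k s a := by
  have hk : k ∈ g.nbhd k := by simp [nbhd, hself]
  by_cases hl : ∃ l ∈ g.nbhd k, k ≠ l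
  swap
  · push Not at hl
    have hone : g.nbhd k = {k} := by
      ext i; constructor
      · intro hi; simp [hl i hi]
      · intro hi; rw [Finset.mem_singleton.1 hi]; exact hk
    -- A lone agent has the factor 1/(1 - 1), read as 0, so its sample variance vanishes.
    refine ⟨1, one_pos, fun st ac n s a => Or.inl ?_⟩
    simp [expSigmaSq, sigmaSq, sampleVar, hone]
  obtain ⟨l, hl, hkl⟩ := hl
  obtain ⟨δ, hδ, hU, hD⟩ := exists_pos_mass_of_variance_ne_zero hbdd hmean hvar
  set ν : Measure (S → A → ℝ) := Measure.pi fun _ => Measure.pi fun _ => g.M with hν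
  set U : Set (S → A → ℝ) := Set.pi Set.univ fun _ => Set.pi Set.univ fun _ => Set.Ici δ with hUdef
  set D : Set (S → A → ℝ) := Set.pi Set.univ fun _ => Set.pi Set.univ fun _ => Set.Iic 0 with hDdef
  have hνU : 0 < ν U := by
    rw [hν, hUdef, Measure.pi_pi]
    simp only [Measure.pi_pi, Finset.prod_const]
    exact ENNReal.pow_pos (ENNReal.pow_pos hU _) _
  have hνD : 0 < ν D := by
    rw [hν, hDdef, Measure.pi_pi]
    simp only [Measure.pi_pi, Finset.prod_const]
    exact ENNReal.pow_pos (ENNReal.pow_pos hD _) _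
  set p : ℝ := min (ν U).toReal (ν D).toReal with hp
  have hp0 : 0 < p := lt_min (ENNReal.toReal_pos hνU.ne' (measure_ne_top _ _))
    (ENNReal.toReal_pos hνD.ne' (measure_ne_top _ _))
  set C : ℝ := (2 * (((g.nbhd k).card : ℝ) - 1))⁻¹ with hC
  have hC0 : 0 < C := by
    have : (1 : ℝ) < (g.nbhd k).card := by
      exact_mod_cast Finset.one_lt_card.2 ⟨k, hk, l, hl, hkl⟩
    exact inv_pos.2 (by linarith)
  -- rectangles in the tables of the agents `k` and `l`
  have hrect : ∀ V W : Set (S → A → ℝ), ν V * ν W ≤ g.initLaw {q | q k ∈ V ∧ q l ∈ W} := by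
    intro V W
    set R : Fin K → Set (S → A → ℝ) := fun i => if i = k then V else if i = l then W else Set.univ
      with hR
    have hsub : Set.pi Set.univ R ⊆ {q | q k ∈ V ∧ q l ∈ W} := fun q hq => by
      have h1 := hq k trivial
      have h2 := hq l trivial
      simp only [hR, if_true, if_neg hkl.symm] at h1 h2
      exact ⟨h1, h2⟩
    refine le_trans (le_of_eq ?_) (measure_mono hsub)
    rw [initLaw, Measure.pi_pi]
    have : ∏ i, ν (R i) = ∏ i ∈ {k, l}, ν (R i) := by
      refine (Finset.prod_subset (Finset.subset_univ _) fun i _ hi => ?_).symm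
      simp only [Finset.mem_insert, Finset.mem_singleton, not_or] at hi
      simp [hR, hi.1, hi.2]
    rw [this, Finset.prod_pair hkl]
    simp [hR, hkl.symm]
  refine ⟨C * (δ / 2) ^ 2 * (p / 2), by positivity, fun st ac n s a => ?_⟩
  by_cases hint : Integrable (fun q => g.sigmaSq q st ac n k s a) g.initLaw
  swap
  -- Without integrability the integral is 0 by convention, which falls under the first alternative.
  · exact Or.inl (integral_undef hint)
  refine Or.inr ?_
  set m := g.influence k (fun i => st i k) (fun i => ac i k) n s a with hm
  have hm0 : 0 < m := (pow_pos g.mdp.γ_pos n).trans_le (g.pow_le_influence k _ _ hstep n s a)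
  set f : (S → A → ℝ) → ℝ := fun q => g.Qhat k q (fun i => st i k) (fun i => ac i k) n s a
  set h : (S → A → ℝ) → ℝ := fun q => g.Qhat l q (fun i => st i l) (fun i => ac i l) n s a
  have hfUD : ∀ u ∈ U, ∀ d ∈ D, f d + δ * m ≤ f u := fun u hu d hd =>
    g.mul_influence_le_Qhat_sub k _ _ hstep hδ.le (fun s a => by
      have h1 : δ ≤ u s a := hu s trivial a trivial
      have h2 : d s a ≤ 0 := hd s trivial a trivial
      linarith) n s a
  have hDne : D.Nonempty := nonempty_of_measure_ne_zero hνD.ne'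
  have hUne : U.Nonempty := nonempty_of_measure_ne_zero hνU.ne'
  have hbddD : BddAbove (f '' D) := by
    obtain ⟨u, hu⟩ := hUne
    refine ⟨f u, ?_⟩
    rintro _ ⟨d, hd, rfl⟩
    have := mul_pos hδ hm0
    linarith [hfUD u hu d hd]
  -- The level y lies at distance at least δ m / 2 from the values of f on D and on U.
  set y : ℝ := sSup (f '' D) + δ * m / 2 with hy
  have hfD : ∀ d ∈ D, f d ≤ y - δ * m / 2 := fun d hd => by
    have := le_csSup hbddD ⟨d, hd, rfl⟩
    linarith
  have hfU : ∀ u ∈ U, y + δ * m / 2 ≤ f u := fun u hu => by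
    have : sSup (f '' D) ≤ f u - δ * m := csSup_le (hDne.image f) (by
      rintro _ ⟨d, hd, rfl⟩
      linarith [hfUD u hu d hd])
    linarith
  set ε : ℝ := C * (δ * m / 2) ^ 2 with hε
  have hsig : ∀ q, C * (f (q k) - h (q l)) ^ 2 ≤ g.sigmaSq q st ac n k s a := fun q =>
    g.sq_sub_le_mul_sampleVar k hk hl hkl
      (fun i => g.Qhat i (q i) (fun j => st j i) (fun j => ac j i) n s a)
  have hsub : ∀ V W : Set (S → A → ℝ),
      (∀ v ∈ V, ∀ w ∈ W, (δ * m / 2) ^ 2 ≤ (f v - h w) ^ 2) →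
      (ν V * ν W).toReal ≤ (g.initLaw {q | ε ≤ g.sigmaSq q st ac n k s a}).toReal := by
    intro V W hVW
    have : IsProbabilityMeasure g.initLaw := by unfold initLaw; infer_instance
    refine ENNReal.toReal_mono (measure_ne_top _ _) ((hrect V W).trans (measure_mono ?_))
    exact fun q hq => (mul_le_mul_of_nonneg_left (hVW _ hq.1 _ hq.2) hC0.le).trans (hsig q)
  have hδm : 0 ≤ δ * m / 2 := by positivity
  have hhalf : p / 2 ≤ (g.initLaw {q | ε ≤ g.sigmaSq q st ac n k s a}).toReal := by
    have hcover : 1 ≤ (ν {q | h q ≤ y}).toReal + (ν {q | y ≤ h q}).toReal := by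
      rw [← ENNReal.toReal_add (measure_ne_top _ _) (measure_ne_top _ _)]
      have : (1 : ℝ≥0∞) ≤ ν {q | h q ≤ y} + ν {q | y ≤ h q} := by
        refine le_trans (le_of_eq ?_) (measure_union_le _ _)
        rw [← measure_univ (μ := ν)]
        congr 1
        ext q
        simp [le_total]
      have := ENNReal.toReal_mono (by finiteness) this
      simpa using this
    have h1 := hsub U {q | h q ≤ y} fun v hv w hw => by
      have := hfU v hv
      have hw' : h w ≤ y := hw
      exact pow_le_pow_left₀ hδm (by linarith) 2
    have h2 := hsub D {q | y ≤ h q} fun v hv w hw => by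
      have := hfD v hv
      have hw' : y ≤ h w := hw
      rw [← neg_sq (f v - h w)]
      exact pow_le_pow_left₀ hδm (by linarith) 2
    rw [ENNReal.toReal_mul] at h1 h2
    rcases le_total (1 / 2) (ν {q | h q ≤ y}).toReal with h3 | h3
    · have := mul_le_mul (min_le_left (ν U).toReal (ν D).toReal) h3 (by norm_num)
        ENNReal.toReal_nonneg
      rw [← hp] at this
      linarith
    · have := mul_le_mul (min_le_right (ν U).toReal (ν D).toReal)
        (by linarith : 1 / 2 ≤ (ν {q | y ≤ h q}).toReal) (by norm_num) ENNReal.toReal_nonneg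
      rw [← hp] at this
      linarith
  have hmarkov := mul_meas_ge_le_integral_of_nonneg (μ := g.initLaw)
    (f := fun q => g.sigmaSq q st ac n k s a)
    (Eventually.of_forall fun q => g.sampleVar_nonneg k hk _) hint ε
  have hε0 : 0 ≤ ε := by positivity
  calc C * (δ / 2) ^ 2 * (p / 2) * m ^ 2 = ε * (p / 2) := by rw [hε]; ring
    _ ≤ ε * (g.initLaw {q | ε ≤ g.sigmaSq q st ac n k s a}).toReal :=
      mul_le_mul_of_nonneg_left hhalf hε0
    _ ≤ _ := hmarkov

/-! ### Lower bounds for the behavioural policy -/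

section Behav

variable [Fintype S] [Fintype A] [Nonempty A]

theorem toReal_behav (q₀ : Fin K → S → A → ℝ) (st : ℕ → Fin K → S) (ac : ℕ → Fin K → A) (n : ℕ)
    (k : Fin K) (s : S) (a : A) :
    (g.behav q₀ st ac n k s a).toReal =
      Real.exp (g.beta q₀ st ac n k s * g.Qtilde q₀ st ac n k s a) /
        ∑ b, Real.exp (g.beta q₀ st ac n k s * g.Qtilde q₀ st ac n k s b) := by
  unfold behav
  rw [PMF.normalize_apply, ENNReal.toReal_mul, ENNReal.toReal_inv, tsum_fintype,
    ENNReal.toReal_sum fun _ _ => ENNReal.ofReal_ne_top,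
    ENNReal.toReal_ofReal (Real.exp_pos _).le, div_eq_mul_inv]
  congr 2
  exact Finset.sum_congr rfl fun b _ => ENNReal.toReal_ofReal (Real.exp_pos _).le

/-- The argument of the logarithm in the definition of `beta`. -/
noncomputable def exploration (st : ℕ → Fin K → S) (ac : ℕ → Fin K → A) (n : ℕ) (k : Fin K)
    (s : S) : ℝ :=
  Real.logb (1 / g.α) (truncBelow (1 / g.α)
    ((variance id g.M ^ Fintype.card A * (((g.nbhd k).card : ℝ) ^ Fintype.card A)⁻¹) /
      ∏ b : A, g.expSigmaSq st ac n k s b))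

theorem one_div_exploration_le_behav (hα : 0 < g.α ∧ g.α ≤ 1 / 4) (q₀ : Fin K → S → A → ℝ)
    (st : ℕ → Fin K → S) (ac : ℕ → Fin K → A) (n : ℕ) (k : Fin K) (s : S) (a : A) :
    1 / (Fintype.card A * g.exploration st ac n k s) ≤ (g.behav q₀ st ac n k s a).toReal := by
  rw [toReal_behav]
  have hL := one_le_truncBelow_logb hα.1 hα.2
    ((variance id g.M ^ Fintype.card A * (((g.nbhd k).card : ℝ) ^ Fintype.card A)⁻¹) /
      ∏ b : A, g.expSigmaSq st ac n k s b)
  refine one_div_card_mul_le_boltzmann (L := g.exploration st ac n k s)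
    (zero_lt_one.trans_le hL) (fun a b => ?_) a
  have hlog : 0 ≤ Real.log (g.exploration st ac n k s) := Real.log_nonneg hL
  have hspread : |g.Qtilde q₀ st ac n k s b - g.Qtilde q₀ st ac n k s a| ≤
      g.spread q₀ st ac n k s :=
    le_ciSup (f := fun p : A × A => |g.Qtilde q₀ st ac n k s p.1 - g.Qtilde q₀ st ac n k s p.2|)
      (Set.finite_range _).bddAbove (b, a)
  have hD : 0 ≤ g.spread q₀ st ac n k s := (abs_nonneg _).trans hspread
  have hβ : g.beta q₀ st ac n k s = 1 / g.spread q₀ st ac n k s *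
    Real.log (g.exploration st ac n k s) := rfl
  rcases hD.eq_or_lt with h0 | h0
  -- If the spread is 0, the division by 0 makes β = 0.
  · rw [hβ, ← h0]; simpa using hlog
  · have h1 := mul_le_mul_of_nonneg_left ((le_abs_self _).trans hspread)
      (show 0 ≤ g.beta q₀ st ac n k s by rw [hβ]; positivity)
    refine h1.trans_eq ?_
    rw [hβ]
    field_simp

open Classical in
/-- Along every path of agent `k`, its probability of selecting an action in the state `s` decays
at most harmonically in the number of visits to `s`. -/
theorem exists_le_behav (hα : 0 < g.α ∧ g.α ≤ 1 / 4) (hself : ∀ k, g.graph.Adj k k)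
    (hstep : ∀ k s a i, 0 ≤ g.step k s a i ∧ g.step k s a i ≤ 1)
    (hlim : ∀ k s a, Tendsto (g.step k s a) atTop (𝓝 0)) [IsProbabilityMeasure g.M]
    (hbdd : ∃ B : ℝ, ∀ᵐ x ∂g.M, |x| ≤ B) (hmean : ∫ x, x ∂g.M = 0)
    (k : Fin K) (st : ℕ → S) (ac : ℕ → A) (s : S) :
    ∃ c > 0, ∀ᶠ n in atTop, ∀ (q₀ : Fin K → S → A → ℝ) (st' : ℕ → Fin K → S)
      (ac' : ℕ → Fin K → A), (∀ i < n, st' i k = st i) → (∀ i < n, ac' i k = ac i) → ∀ a,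
      c / (1 + Nat.count (fun i => st i = s) n) ≤ (g.behav q₀ st' ac' n k s a).toReal := by
  suffices h : ∃ C > 0, ∀ᶠ n in atTop, ∀ (st' : ℕ → Fin K → S)
      (ac' : ℕ → Fin K → A), (∀ i < n, st' i k = st i) → (∀ i < n, ac' i k = ac i) →
      g.exploration st' ac' n k s ≤ C + Nat.count (fun i => st i = s) n by
    obtain ⟨C, hC, hev⟩ := h
    have hcard : (0 : ℝ) < Fintype.card A := by exact_mod_cast Fintype.card_pos
    refine ⟨1 / (Fintype.card A * (C + 1)), by positivity, hev.mono fun n hn q₀ st' ac' h1 h2 a => ?_⟩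
    refine le_trans ?_ (g.one_div_exploration_le_behav hα q₀ st' ac' n k s a)
    have h3 := hn st' ac' h1 h2
    have hL : 1 ≤ g.exploration st' ac' n k s := one_le_truncBelow_logb hα.1 hα.2 _
    rw [div_div]
    refine one_div_le_one_div_of_le (by positivity) ?_
    rw [mul_assoc]
    refine mul_le_mul_of_nonneg_left (h3.trans ?_) hcard.le
    have := mul_nonneg hC.le (Nat.cast_nonneg (α := ℝ) (Nat.count (fun i => st i = s) n))
    linarith
  have hb : 1 < 1 / g.α := by rw [lt_div_iff₀ hα.1]; linarith
  have hClog : ∀ C : ℝ, 0 < C → 0 < Real.logb (1 / g.α) (1 / g.α + C) := fun C hC =>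
    Real.logb_pos hb (by linarith)
  by_cases hvar : variance id g.M = 0
  -- For a degenerate initial law the quotient is 0, and only the truncation level remains.
  · refine ⟨_, hClog 1 one_pos, Eventually.of_forall fun n st' ac' _ _ => ?_⟩
    refine logb_truncBelow_le hα.1 hα.2 one_pos ?_
    rw [hvar, zero_pow Fintype.card_ne_zero]
    simp
  obtain ⟨c, hc, hE⟩ := g.exists_mul_influence_sq_le_expSigmaSq k hstep hself hbdd hmean hvar
  choose κ hκ hinf using g.exists_influence_ge k st ac hstep hlim s
  set Y : ℝ := variance id g.M ^ Fintype.card A * (((g.nbhd k).card : ℝ) ^ Fintype.card A)⁻¹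
    with hY
  have hY0 : 0 ≤ Y := by have := variance_nonneg id g.M; positivity
  set Z : ℝ := ∏ b, (c * κ b ^ 2) with hZ
  have hZ0 : 0 < Z := Finset.prod_pos fun b _ => mul_pos hc (pow_pos (hκ b) 2)
  have hC0 : 0 < Y / Z + 1 := by positivity
  refine ⟨_, hClog (Y / Z + 1) hC0, ?_⟩
  filter_upwards [eventually_all.2 hinf] with n hn st' ac' hst hac
  refine logb_truncBelow_le hα.1 hα.2 hC0 ?_
  have h4 : (1 : ℝ) ≤ 4 ^ Nat.count (fun i => st i = s) n := one_le_pow₀ (by norm_num)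
  by_cases hzero : ∃ b, g.expSigmaSq st' ac' n k s b = 0
  · obtain ⟨b, hb⟩ := hzero
    rw [Finset.prod_eq_zero (Finset.mem_univ b) hb, div_zero]
    positivity
  · push Not at hzero
    have hge : ∀ b, c * κ b ^ 2 ≤ g.expSigmaSq st' ac' n k s b * 4 ^ visits st ac n s b := by
      intro b
      have h1 := (hE st' ac' n s b).resolve_left (hzero b)
      rw [g.influence_congr k (st := fun i => st' i k) (ac := fun i => ac' i k) hst hac] at h1
      have h2 := pow_le_pow_left₀ (hκ b).le (hn b) 2
      have h3 := mul_le_mul_of_nonneg_right h1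
        (pow_nonneg (by norm_num : (0 : ℝ) ≤ 4) (visits st ac n s b))
      refine le_trans ?_ h3
      have e : (4 : ℝ) ^ visits st ac n s b = (2 ^ visits st ac n s b) ^ 2 := by
        rw [← pow_mul, mul_comm, pow_mul]; norm_num
      rw [mul_assoc, e, ← mul_pow]
      exact mul_le_mul_of_nonneg_left h2 hc.le
    have hprod : Z ≤ (∏ b, g.expSigmaSq st' ac' n k s b) *
        4 ^ Nat.count (fun i => st i = s) n := by
      -- The exponents add up over the actions: visits to the pairs at s sum to visits to s.
      rw [← sum_visits st ac n s, ← Finset.prod_pow_eq_pow_sum, ← Finset.prod_mul_distrib]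
      exact Finset.prod_le_prod (fun b _ => (mul_pos hc (pow_pos (hκ b) 2)).le) fun b _ => hge b
    have hEpos : 0 < ∏ b, g.expSigmaSq st' ac' n k s b := by
      by_contra hneg
      have := mul_nonpos_of_nonpos_of_nonneg (not_lt.1 hneg)
        (pow_nonneg (by norm_num : (0 : ℝ) ≤ 4) (Nat.count (fun i => st i = s) n))
      linarith
    have : Y / (∏ b, g.expSigmaSq st' ac' n k s b) ≤
        Y / Z * 4 ^ Nat.count (fun i => st i = s) n := by
      rw [div_mul_eq_mul_div, div_le_div_iff₀ hEpos hZ0]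
      calc Y * Z ≤ Y * _ := mul_le_mul_of_nonneg_left hprod hY0
        _ = _ := by ring
    refine this.trans ?_
    rw [add_mul]
    linarith

end Behav

end GEA

/-! ### Independent moves of the agents -/

theorem sum_indepPMF_toReal_mul {ι X : Type*} [Fintype ι] [DecidableEq ι] [Fintype X]
    (p : ι → PMF X) (k : ι) (φ : X → ℝ) :
    ∑ x, (indepPMF p x).toReal * φ (x k) = ∑ y, (p k y).toReal * φ y := by
  have h := Finset.prod_univ_sum (fun _ : ι => (Finset.univ : Finset X))
    (fun i y => (p i y).toReal * if i = k then φ y else 1)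
  rw [Fintype.piFinset_univ] at h
  have h1 : ∀ x : ι → X, (indepPMF p x).toReal * φ (x k) =
      ∏ i, (p i (x i)).toReal * if i = k then φ (x i) else 1 := fun x => by
    rw [Finset.prod_mul_distrib, Finset.prod_ite_eq' Finset.univ k (fun i => φ (x i)),
      if_pos (Finset.mem_univ k)]
    congr 1
    rw [← ENNReal.toReal_prod]
    rfl
  simp only [h1]
  rw [← h, Finset.prod_eq_single k]
  · simp
  · intro i _ hi
    simp [hi, (p i).sum_toReal_eq_one]
  · simp

/-! ### Divergent series -/

theorem tendsto_sum_atTop_of_eventually_le {f g : ℕ → ℝ} (h : ∀ᶠ n in atTop, g n ≤ f n)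
    (hg : Tendsto (fun n => ∑ i ∈ Finset.range n, g i) atTop atTop) :
    Tendsto (fun n => ∑ i ∈ Finset.range n, f i) atTop atTop := by
  obtain ⟨N, hN⟩ := eventually_atTop.1 h
  refine tendsto_atTop_mono' atTop (f₁ := fun n => ∑ i ∈ Finset.range n, g i +
    (∑ i ∈ Finset.range N, f i - ∑ i ∈ Finset.range N, g i)) ?_
    (tendsto_atTop_add_const_right _ _ hg)
  filter_upwards [eventually_ge_atTop N] with n hn
  induction n, hn using Nat.le_induction with
  | base => linarith
  | succ n hn ih =>
    rw [Finset.sum_range_succ, Finset.sum_range_succ]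
    linarith [hN n hn]

theorem tendsto_sum_div_one_add_atTop {c : ℝ} (hc : 0 < c) :
    Tendsto (fun n => ∑ j ∈ Finset.range n, c / (1 + (j : ℝ))) atTop atTop := by
  have h := Real.tendsto_sum_range_one_div_nat_succ_atTop.const_mul_atTop hc
  refine h.congr fun n => ?_
  rw [Finset.mul_sum]
  exact Finset.sum_congr rfl fun j _ => by rw [add_comm, mul_one_div]

namespace GEA

open PathLaw

variable {K : ℕ} {S A : Type*} (g : GEA K S A)
  [Fintype S] [Fintype A] [Nonempty A]

/-- The conditional law of the next state-action pairs of all agents. -/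
noncomputable def runNext (q₀ : Fin K → S → A → ℝ) (n : ℕ) (ω : ℕ → Fin K → S × A) :
    PMF (Fin K → S × A) :=
  (indepPMF (fun k => g.mdp.P (ω n k).1 (ω n k).2)).bind (fun s' =>
    g.actLaw q₀ (fun i k => if i ≤ n then (ω i k).1 else s' k) (fun i k => (ω i k).2) (n + 1))

variable (q₀ : Fin K → S → A → ℝ)

theorem dependsOn_runNext (n : ℕ) : DependsOn (g.runNext q₀ n) (Set.Iic n) := fun x y h => by
  have h' : ∀ i ≤ n, x i = y i := fun i hi => h i hi
  unfold runNext
  rw [h' n le_rfl]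
  congr 1
  funext s'
  unfold actLaw
  rw [g.behav_congr q₀ (n := n + 1) (st' := fun i k => if i ≤ n then (y i k).1 else s' k)
    (ac' := fun i k => (y i k).2)]
  · simp
  · intro i _
    funext k
    by_cases hi : i ≤ n
    · simp [hi, h' i hi]
    · simp [hi]
  · intro i hi
    funext k
    rw [h' i (by omega)]

theorem condMean_runNext_state (n : ℕ) (k : Fin K) (φ : (ℕ → Fin K → S × A) → S → ℝ)
    (ω : ℕ → Fin K → S × A) :
    condMean (g.runNext q₀) n (fun ω y => φ ω (y k).1) ω =
      ∑ s', (g.mdp.P (ω n k).1 (ω n k).2 s').toReal * φ ω s' := by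
  simp only [condMean, runNext]
  rw [PMF.sum_bind_toReal_mul _ _ (fun y : Fin K → S × A => φ ω (y k).1),
    ← sum_indepPMF_toReal_mul (fun k => g.mdp.P (ω n k).1 (ω n k).2) k]
  refine Finset.sum_congr rfl fun s' _ => ?_
  congr 1
  unfold actLaw
  rw [PMF.sum_map_toReal_mul _ _ (fun y : Fin K → S × A => φ ω (y k).1)]
  simp [← Finset.sum_mul, PMF.sum_toReal_eq_one]

open Classical in
-- The lower bound on the policy is required for every joint next state s' because the policy of
-- agent k may also depend on where the other agents move.
theorem mul_le_condMean_runNext (n : ℕ) (k : Fin K) (ω : ℕ → Fin K → S × A) (s : S) (a : A)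
    {h : ℝ} (hh : ∀ s' : Fin K → S, h ≤ (g.behav q₀ (fun i k => if i ≤ n then (ω i k).1 else s' k)
      (fun i k => (ω i k).2) (n + 1) k s a).toReal) :
    (g.mdp.P (ω n k).1 (ω n k).2 s).toReal * h ≤
      condMean (g.runNext q₀) n (fun _ y => if y k = (s, a) then 1 else 0) ω := by
  simp only [condMean, runNext]
  rw [PMF.sum_bind_toReal_mul _ _ (fun y : Fin K → S × A => if y k = (s, a) then (1 : ℝ) else 0)]
  have e : (g.mdp.P (ω n k).1 (ω n k).2 s).toReal * h =
      ∑ s', (indepPMF (fun k => g.mdp.P (ω n k).1 (ω n k).2) s').toReal *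
        (if s' k = s then h else 0) := by
    rw [sum_indepPMF_toReal_mul (fun k => g.mdp.P (ω n k).1 (ω n k).2) k
      (fun x => if x = s then h else 0)]
    simp
  rw [e]
  refine Finset.sum_le_sum fun s' _ => mul_le_mul_of_nonneg_left ?_ ENNReal.toReal_nonneg
  unfold actLaw
  rw [PMF.sum_map_toReal_mul _ _ (fun y : Fin K → S × A => if y k = (s, a) then (1 : ℝ) else 0)]
  split_ifs with hs
  · refine (hh s').trans (le_of_eq ?_)
    simp only [Prod.mk.injEq]
    rw [sum_indepPMF_toReal_mul _ k (fun x => if (if n + 1 ≤ n then (ω (n + 1) k).1 else s' k) = s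
      ∧ x = a then (1 : ℝ) else 0)]
    simp [hs]
  · exact Finset.sum_nonneg fun x _ => mul_nonneg ENNReal.toReal_nonneg (by split_ifs <;> simp)

variable [MeasurableSpace S] [MeasurableSingletonClass S]
  [MeasurableSpace A] [MeasurableSingletonClass A]

theorem runLaw_eq (s₀ : Fin K → S) : g.runLaw q₀ s₀ =
    pathLaw (g.actLaw q₀ (fun _ => s₀) (fun _ _ => Classical.arbitrary A) 0) (g.runNext q₀) := rfl

/-! ### Exploration -/

open Classical in
theorem ae_frequently_state_of_frequently (s₀ : Fin K → S) (k : Fin K) (s : S) (a : A) (s' : S)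
    (hP : 0 < g.mdp.P s a s') :
    ∀ᵐ ω ∂(g.runLaw q₀ s₀), (∃ᶠ n in atTop, ω n k = (s, a)) → ∃ᶠ n in atTop, (ω n k).1 = s' := by
  rw [runLaw_eq]
  filter_upwards [ae_frequently_iff (g.dependsOn_runNext q₀)
    (fun n ω y => ω n k = (s, a) ∧ (y k).1 = s')
    (fun n x y h => by simp only [h n (Set.mem_Iic.2 le_rfl)])] with ω hω hfr
  have hc : ∀ n, condMean (g.runNext q₀) n (fun ω y =>
      if ω n k = (s, a) ∧ (y k).1 = s' then 1 else 0) ω =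
      if ω n k = (s, a) then (g.mdp.P s a s').toReal else 0 := fun n => by
    rw [g.condMean_runNext_state q₀ n k (fun ω x => if ω n k = (s, a) ∧ x = s' then 1 else 0)]
    by_cases h : ω n k = (s, a) <;> simp [h]
  simp only [hc] at hω
  have hp : 0 < (g.mdp.P s a s').toReal := ENNReal.toReal_pos hP.ne' (PMF.apply_ne_top _ _)
  have hdiv : Tendsto (fun n : ℕ => ∑ j ∈ Finset.range n, (fun _ => (g.mdp.P s a s').toReal) j)
      atTop atTop := by
    simp only [Finset.sum_const, Finset.card_range, nsmul_eq_mul]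
    exact tendsto_natCast_atTop_atTop.atTop_mul_const hp
  have hsum := tendsto_sum_ite_count_atTop hfr hdiv
  have h1 := hω.2 hsum
  rw [frequently_atTop] at h1 ⊢
  intro N
  obtain ⟨n, hn, h2⟩ := h1 N
  exact ⟨n + 1, by omega, h2.2⟩

open Classical in
-- Impossible transitions have conditional probability 0, so the other direction of Borel-Cantelli
-- allows only finitely many.
theorem ae_eventually_pos_transition (s₀ : Fin K → S) (k : Fin K) (s : S) :
    ∀ᵐ ω ∂(g.runLaw q₀ s₀), ∀ᶠ n in atTop, (ω (n + 1) k).1 = s →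
      g.mdp.P (ω n k).1 (ω n k).2 s ≠ 0 := by
  rw [runLaw_eq]
  filter_upwards [ae_frequently_iff (g.dependsOn_runNext q₀)
    (fun n ω y => g.mdp.P (ω n k).1 (ω n k).2 s = 0 ∧ (y k).1 = s)
    (fun n x y h => by simp only [h n (Set.mem_Iic.2 le_rfl)])] with ω hω
  have hc : ∀ n, condMean (g.runNext q₀) n (fun ω y =>
      if g.mdp.P (ω n k).1 (ω n k).2 s = 0 ∧ (y k).1 = s then 1 else 0) ω = 0 := fun n => by
    rw [g.condMean_runNext_state q₀ n k
      (fun ω x => if g.mdp.P (ω n k).1 (ω n k).2 s = 0 ∧ x = s then 1 else 0)]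
    by_cases h : g.mdp.P (ω n k).1 (ω n k).2 s = 0 <;> simp [h]
  simp only [hc, Finset.sum_const_zero] at hω
  have h1 : ¬ ∃ᶠ n in atTop, g.mdp.P (ω n k).1 (ω n k).2 s = 0 ∧ (ω (n + 1) k).1 = s := fun h =>
    not_tendsto_const_atTop _ _ (hω.1 h)
  exact (not_frequently.1 h1).mono fun n hn hs h0 => hn ⟨h0, hs⟩

open Classical in
-- The conditional probability of hitting (s, a) next is a transition probability times a policy
-- probability. It is summed over the times `pred` at which s is a possible successor, because the
-- transition factor is bounded below there. Visits to s are, up to a constant, no more numerous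
-- than these times, so the harmonic bound can be rewritten in their count.
theorem ae_frequently_pair_of_frequently_state (hα : 0 < g.α ∧ g.α ≤ 1 / 4)
    (hself : ∀ k, g.graph.Adj k k)
    (hstep : ∀ k s a i, 0 ≤ g.step k s a i ∧ g.step k s a i ≤ 1)
    (hlim : ∀ k s a, Tendsto (g.step k s a) atTop (𝓝 0)) [IsProbabilityMeasure g.M]
    (hbdd : ∃ B : ℝ, ∀ᵐ x ∂g.M, |x| ≤ B) (hmean : ∫ x, x ∂g.M = 0)
    (s₀ : Fin K → S) (k : Fin K) (s : S) (a : A) :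
    ∀ᵐ ω ∂(g.runLaw q₀ s₀), (∃ᶠ n in atTop, (ω n k).1 = s) → ∃ᶠ n in atTop, ω n k = (s, a) := by
  have hpos := g.ae_eventually_pos_transition q₀ s₀ k s
  rw [runLaw_eq] at hpos ⊢
  filter_upwards [hpos, ae_frequently_iff (g.dependsOn_runNext q₀)
    (fun _ _ y => y k = (s, a)) (fun n x y h => rfl)] with ω hω hBC hfr
  suffices h : Tendsto (fun n => ∑ j ∈ Finset.range n, condMean (g.runNext q₀) j
      (fun _ y => if y k = (s, a) then 1 else 0) ω) atTop atTop by
    have h1 := hBC.2 h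
    rw [frequently_atTop] at h1 ⊢
    intro N
    obtain ⟨n, hn, h2⟩ := h1 N
    exact ⟨n + 1, by omega, h2⟩
  obtain ⟨c, hc, hbehav⟩ := g.exists_le_behav hα hself hstep hlim hbdd hmean k
    (fun i => (ω i k).1) (fun i => (ω i k).2) s
  set pred : ℕ → Prop := fun n => g.mdp.P (ω n k).1 (ω n k).2 s ≠ 0 with hpred
  obtain ⟨N, hN⟩ := eventually_atTop.1 hω
  have hcount : ∀ n, Nat.count (fun i => (ω i k).1 = s) (n + 1) ≤ N + 1 + Nat.count pred n := by
    intro n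
    rcases le_total n N with hn | hn
    · exact (Nat.count_le (fun i => (ω i k).1 = s)).trans (by omega)
    · induction n, hn using Nat.le_induction with
      | base => exact (Nat.count_le (fun i => (ω i k).1 = s)).trans (by omega)
      | succ n hn ih =>
        rw [Nat.count_succ, Nat.count_succ (p := pred)]
        by_cases h : (ω (n + 1) k).1 = s
        · have : pred n := hN n hn h
          simp only [h, this, if_true]; omega
        · simp only [h, if_false]; omega
  have hfrpred : ∃ᶠ n in atTop, pred n := by
    rw [frequently_atTop] at hfr ⊢
    intro b
    obtain ⟨n, hn, h⟩ := hfr (max b N + 1)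
    obtain ⟨n, rfl⟩ : ∃ m, n = m + 1 := ⟨n - 1, by omega⟩
    exact ⟨n, by omega, hN n (by omega) h⟩
  obtain ⟨p, hp0, hp⟩ : ∃ p > 0, ∀ x b, g.mdp.P x b s ≠ 0 → p ≤ (g.mdp.P x b s).toReal := by
    have : Nonempty S := ⟨s⟩
    obtain ⟨z, hz⟩ := Finite.exists_min (fun z : S × A =>
      -- The value 1 is a filler that keeps the minimum over the finite set positive.
      if g.mdp.P z.1 z.2 s = 0 then (1 : ℝ) else (g.mdp.P z.1 z.2 s).toReal)
    refine ⟨_, ?_, fun x b hxb => (hz (x, b)).trans (by simp [hxb])⟩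
    split_ifs with h
    · exact one_pos
    · exact ENNReal.toReal_pos h (PMF.apply_ne_top _ _)
  set C : ℝ := p * (c / (N + 2)) with hC
  have hC0 : 0 < C := by positivity
  have hdiv := tendsto_sum_ite_count_atTop hfrpred (tendsto_sum_div_one_add_atTop hC0)
  refine tendsto_sum_atTop_of_eventually_le ?_ hdiv
  filter_upwards [(tendsto_add_atTop_nat 1).eventually hbehav] with n hn
  have hle := g.mul_le_condMean_runNext q₀ n k ω s a
    (h := c / (1 + Nat.count (fun i => (ω i k).1 = s) (n + 1))) fun s' =>
      hn q₀ _ _ (fun i hi => by simp [Nat.lt_succ_iff.1 hi]) (fun i _ => rfl) a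
  refine le_trans ?_ hle
  have hh : c / (N + 2) / (1 + (Nat.count pred n : ℝ)) ≤
      c / (1 + Nat.count (fun i => (ω i k).1 = s) (n + 1)) := by
    rw [div_div]
    refine div_le_div_of_nonneg_left hc.le (by positivity) ?_
    have h1 : (Nat.count (fun i => (ω i k).1 = s) (n + 1) : ℝ) ≤ N + 1 + Nat.count pred n := by
      exact_mod_cast hcount n
    -- With c the count of `pred`, this is 1 + (N + 1 + c) ≤ (N + 2)(1 + c).
    nlinarith [mul_nonneg (Nat.cast_nonneg (α := ℝ) N) (Nat.cast_nonneg (α := ℝ) (Nat.count pred n)),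
      Nat.cast_nonneg (α := ℝ) (Nat.count pred n)]
  split_ifs with h
  · rw [hC, mul_div_assoc]
    exact mul_le_mul (hp _ _ h) hh (by positivity) ENNReal.toReal_nonneg
  · positivity

/-- Every agent visits every state-action pair infinitely often. -/
theorem ae_frequently_pair (hα : 0 < g.α ∧ g.α ≤ 1 / 4) (hself : ∀ k, g.graph.Adj k k)
    (hstep : ∀ k s a i, 0 ≤ g.step k s a i ∧ g.step k s a i ≤ 1)
    (hlim : ∀ k s a, Tendsto (g.step k s a) atTop (𝓝 0)) [IsProbabilityMeasure g.M]
    (hbdd : ∃ B : ℝ, ∀ᵐ x ∂g.M, |x| ≤ B) (hmean : ∫ x, x ∂g.M = 0)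
    (hreach : g.mdp.Reachable) (s₀ : Fin K → S) :
    ∀ᵐ ω ∂(g.runLaw q₀ s₀), ∀ k s a, ∃ᶠ n in atTop, ω n k = (s, a) := by
  have h1 : ∀ᵐ ω ∂(g.runLaw q₀ s₀), ∀ k s a, (∃ᶠ n in atTop, (ω n k).1 = s) →
      ∃ᶠ n in atTop, ω n k = (s, a) :=
    ae_all_iff.2 fun k => ae_all_iff.2 fun s => ae_all_iff.2 fun a =>
      g.ae_frequently_pair_of_frequently_state q₀ hα hself hstep hlim hbdd hmean s₀ k s a
  have h2 : ∀ᵐ ω ∂(g.runLaw q₀ s₀), ∀ k s a s', 0 < g.mdp.P s a s' →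
      (∃ᶠ n in atTop, ω n k = (s, a)) → ∃ᶠ n in atTop, (ω n k).1 = s' :=
    ae_all_iff.2 fun k => ae_all_iff.2 fun s => ae_all_iff.2 fun a => ae_all_iff.2 fun s' => by
      by_cases hP : 0 < g.mdp.P s a s'
      · exact (g.ae_frequently_state_of_frequently q₀ s₀ k s a s' hP).mono fun _ h _ => h
      · exact Eventually.of_forall fun _ h => absurd h hP
  filter_upwards [h1, h2] with ω hω1 hω2 k s a
  -- Among finitely many states one must recur.
  obtain ⟨t, ht⟩ : ∃ t, ∃ᶠ n in atTop, (ω n k).1 = t := by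
    by_contra! h
    obtain ⟨n, hn⟩ := (eventually_all.2 h).exists
    exact hn _ rfl
  have hall : ∀ u, Relation.ReflTransGen (fun x y => ∃ a, 0 < g.mdp.P x a y) t u →
      ∃ᶠ n in atTop, (ω n k).1 = u := fun u hu => by
    induction hu with
    | refl => exact ht
    | tail _ hstep' ih =>
      obtain ⟨b, hb⟩ := hstep'
      exact hω2 k _ b _ hb (hω1 k _ b ih)
  exact hω1 k s a (hall s (hreach t s))

end GEA

/-! ### Convergence of the Q-tables -/

namespace GEA

open PathLaw

variable {K : ℕ} {S A : Type*} (g : GEA K S A)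

/-- Once B ≥ R/(1 - γ), the update target stays in [-B, B], and an update is a convex combination.
The bound is uniform over all paths. -/
theorem exists_abs_Qhat_le [Finite S] [Finite A] [Nonempty A]
    (hstep : ∀ k s a i, 0 ≤ g.step k s a i ∧ g.step k s a i ≤ 1) (k : Fin K) (q : S → A → ℝ) :
    ∃ B, ∀ st ac n s a, |g.Qhat k q st ac n s a| ≤ B := by
  obtain ⟨R, hR⟩ := (Set.finite_range
    (fun p : S × A × S => |g.mdp.r p.1 p.2.1 p.2.2|)).bddAbove
  have hR : ∀ s a s', |g.mdp.r s a s'| ≤ R := fun s a s' => hR ⟨(s, a, s'), rfl⟩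
  obtain ⟨C, hC⟩ := (Set.finite_range (fun p : S × A => |q p.1 p.2|)).bddAbove
  have hC : ∀ s a, |q s a| ≤ C := fun s a => hC ⟨(s, a), rfl⟩
  have hγ : 0 < 1 - g.mdp.γ := by linarith [g.mdp.γ_lt_one]
  refine ⟨max C (R / (1 - g.mdp.γ)), fun st ac n => ?_⟩
  set B := max C (R / (1 - g.mdp.γ)) with hB
  have hRB : R + g.mdp.γ * B ≤ B := by
    have : R / (1 - g.mdp.γ) ≤ B := le_max_right _ _
    rw [div_le_iff₀ hγ] at this
    linarith
  induction n with
  | zero => exact fun s a => (hC s a).trans (le_max_left _ _)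
  | succ n ih =>
    intro s a
    simp only [Qhat]
    split_ifs
    · obtain ⟨h0, h1⟩ := hstep k s a (visits st ac n s a)
      set α := g.step k s a (visits st ac n s a)
      have hsup : |⨆ b, g.Qhat k q st ac n (st (n + 1)) b| ≤ B := by
        have := abs_iSup_sub_iSup_le (f := fun b => g.Qhat k q st ac n (st (n + 1)) b)
          (g := fun _ => 0) (d := B) fun b => by simpa using ih (st (n + 1)) b
        simpa using this
      have ht : |g.mdp.r s a (st (n + 1)) +
          g.mdp.γ * ⨆ b, g.Qhat k q st ac n (st (n + 1)) b| ≤ B := by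
        refine (abs_add_le _ _).trans (le_trans (add_le_add (hR _ _ _) ?_) hRB)
        rw [abs_mul, abs_of_pos g.mdp.γ_pos]
        exact mul_le_mul_of_nonneg_left hsup g.mdp.γ_pos.le
      have e : ∀ x y : ℝ, x + α * (y - x) = (1 - α) * x + α * y := fun x y => by ring
      rw [e]
      refine (abs_add_le _ _).trans ?_
      rw [abs_mul, abs_mul, abs_of_nonneg h0, abs_of_nonneg (sub_nonneg.2 h1)]
      have h2 := mul_le_mul_of_nonneg_left (ih s a) (sub_nonneg.2 h1)
      have h3 := mul_le_mul_of_nonneg_left ht h0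
      linarith
    · exact ih s a

variable (q₀ : Fin K → S → A → ℝ) (k : Fin K)

open Classical in
/-- The step size used by agent `k` for the pair `(s, a)` at time `n`, zero if it is not visited. -/
noncomputable def rate (n : ℕ) (ω : ℕ → Fin K → S × A) (s : S) (a : A) : ℝ :=
  if (ω n k).1 = s ∧ (ω n k).2 = a then
    g.step k s a (visits (fun i => (ω i k).1) (fun i => (ω i k).2) n s a) else 0

/-- The deviation of the update target from its conditional mean, when `x` is the next state. -/
noncomputable def targetNoise [Fintype S] (n : ℕ) (ω : ℕ → Fin K → S × A) (x : S) (s : S)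
    (a : A) : ℝ :=
  g.mdp.r s a x + g.mdp.γ * (⨆ b, g.runQ q₀ n ω k x b) - g.mdp.bellman (g.runQ q₀ n ω k) s a

theorem rate_mem (hstep : ∀ k s a i, 0 ≤ g.step k s a i ∧ g.step k s a i ≤ 1) (n : ℕ)
    (ω : ℕ → Fin K → S × A) (s : S) (a : A) : 0 ≤ g.rate k n ω s a ∧ g.rate k n ω s a ≤ 1 := by
  unfold rate
  split_ifs
  · exact hstep _ _ _ _
  · exact ⟨le_rfl, zero_le_one⟩

theorem sum_comp_rate (f : ℝ → ℝ) (hf : f 0 = 0) (n : ℕ) (ω : ℕ → Fin K → S × A) (s : S) (a : A) :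
    ∑ i ∈ Finset.range n, f (g.rate k i ω s a) = ∑ j ∈ Finset.range
      (visits (fun i => (ω i k).1) (fun i => (ω i k).2) n s a), f (g.step k s a j) := by
  classical
  rw [visits_eq_count, ← sum_ite_count _ (fun j => f (g.step k s a j))]
  refine Finset.sum_congr rfl fun i _ => ?_
  unfold rate
  rw [visits_eq_count]
  split_ifs
  · rfl
  · exact hf

theorem tendsto_sum_rate_atTop
    (hstep1 : ∀ k s a, Tendsto (fun n => ∑ i ∈ Finset.range n, g.step k s a i) atTop atTop)
    {ω : ℕ → Fin K → S × A} {s : S} {a : A} (h : ∃ᶠ n in atTop, ω n k = (s, a)) :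
    Tendsto (fun n => ∑ i ∈ Finset.range n, g.rate k i ω s a) atTop atTop := by
  classical
  simp only [g.sum_comp_rate k (fun x => x) rfl _ ω s a, visits_eq_count]
  exact (hstep1 k s a).comp (tendsto_count_atTop (h.mono fun n hn => by simp [hn]))

theorem dependsOn_runQ (n : ℕ) : DependsOn (fun ω => g.runQ q₀ n ω k) (Set.Iic n) :=
  fun x y h => g.Qhat_congr k (q₀ k) (fun i hi => by rw [h i hi])
    (fun i hi => by rw [h i (Set.mem_Iic.2 hi.le)])

theorem dependsOn_rate (n : ℕ) (s : S) (a : A) :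
    DependsOn (fun ω => g.rate k n ω s a) (Set.Iic n) := fun x y h => by
  simp only [rate]
  rw [h n (Set.mem_Iic.2 le_rfl), visits_congr (fun i hi => by rw [h i (Set.mem_Iic.2 hi.le)])
    (fun i hi => by rw [h i (Set.mem_Iic.2 hi.le)])]

theorem runQ_succ [Fintype S] (n : ℕ) (ω : ℕ → Fin K → S × A) (s : S) (a : A) :
    g.runQ q₀ (n + 1) ω k s a = (1 - g.rate k n ω s a) * g.runQ q₀ n ω k s a +
      g.rate k n ω s a * (g.mdp.bellman (g.runQ q₀ n ω k) s a +
        g.targetNoise q₀ k n ω (ω (n + 1) k).1 s a) := by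
  have e : g.runQ q₀ (n + 1) ω k s a = g.runQ q₀ n ω k s a + g.rate k n ω s a *
      (g.mdp.r s a (ω (n + 1) k).1 + g.mdp.γ * (⨆ b, g.runQ q₀ n ω k (ω (n + 1) k).1 b) -
        g.runQ q₀ n ω k s a) := by
    simp only [runQ, Qhat, rate]
    split_ifs <;> simp
  rw [e, targetNoise]
  ring

variable [Fintype S] [MeasurableSpace S] [MeasurableSingletonClass S]
  [Fintype A] [Nonempty A] [MeasurableSpace A] [MeasurableSingletonClass A]

theorem ae_exists_tendsto_sum_noise
    (hstep : ∀ k s a i, 0 ≤ g.step k s a i ∧ g.step k s a i ≤ 1)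
    (hstep2 : ∀ k s a, Summable (fun i => g.step k s a i ^ 2)) (s₀ : Fin K → S) (s : S) (a : A) :
    ∀ᵐ ω ∂(g.runLaw q₀ s₀), ∃ c, Tendsto (fun n => ∑ i ∈ Finset.range n,
      g.rate k i ω s a * g.targetNoise q₀ k i ω (ω (i + 1) k).1 s a) atTop (𝓝 c) := by
  obtain ⟨B, hB⟩ := g.exists_abs_Qhat_le hstep k (q₀ k)
  obtain ⟨R, hR⟩ := (Set.finite_range (fun x : S => |g.mdp.r s a x|)).bddAbove
  have hR : ∀ x, |g.mdp.r s a x| ≤ R := fun x => hR ⟨x, rfl⟩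
  have htarget : ∀ n ω x, |g.mdp.r s a x + g.mdp.γ * ⨆ b, g.runQ q₀ n ω k x b| ≤
      R + g.mdp.γ * B := fun n ω x => by
    refine (abs_add_le _ _).trans (add_le_add (hR x) ?_)
    rw [abs_mul, abs_of_pos g.mdp.γ_pos]
    refine mul_le_mul_of_nonneg_left ?_ g.mdp.γ_pos.le
    have := abs_iSup_sub_iSup_le (f := fun b => g.runQ q₀ n ω k x b)
      (g := fun _ => 0) (d := B) fun b => by simpa [runQ] using hB _ _ n x b
    simpa using this
  obtain ⟨D, hnoise⟩ : ∃ D, ∀ n ω x, |g.targetNoise q₀ k n ω x s a| ≤ D := by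
    refine ⟨2 * (R + g.mdp.γ * B), fun n ω x => ?_⟩
    have h1 := htarget n ω x
    have h2 : |g.mdp.bellman (g.runQ q₀ n ω k) s a| ≤ R + g.mdp.γ * B :=
      abs_le.2 ⟨(g.mdp.P s a).le_sum_toReal_mul fun x _ => (abs_le.1 (htarget n ω x)).1,
        (g.mdp.P s a).sum_toReal_mul_le fun x _ => (abs_le.1 (htarget n ω x)).2⟩
    exact (abs_sub _ _).trans (by linarith)
  rw [runLaw_eq]
  refine ae_exists_tendsto_sum (g.dependsOn_runNext q₀)
    (F := fun n ω y => g.rate k n ω s a * g.targetNoise q₀ k n ω (y k).1 s a)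
    (fun n x y h => ?_) (fun n ω => ?_)
    -- The bound is deterministic: along any path each step size of the pair is used at most once.
    (C := D ^ 2 * ∑' i, g.step k s a i ^ 2) (fun n ω => ?_)
  · have h1 : g.rate k n x s a = g.rate k n y s a := g.dependsOn_rate k n s a h
    have h2 : g.runQ q₀ n x k = g.runQ q₀ n y k := g.dependsOn_runQ q₀ k n h
    simp only [h1, targetNoise, h2]
  · rw [g.condMean_runNext_state q₀ n k
      (fun ω x => g.rate k n ω s a * g.targetNoise q₀ k n ω x s a)]
    -- On a visit the next state has law P(·|s, a), which centres the noise; otherwise the rate is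
    -- 0.
    by_cases hv : (ω n k).1 = s ∧ (ω n k).2 = a
    · rw [hv.1, hv.2]
      have h1 := (g.mdp.P s a).sum_toReal_eq_one
      simp only [mul_left_comm _ (g.rate k n ω s a), ← Finset.mul_sum]
      simp only [targetNoise, mul_sub, Finset.sum_sub_distrib]
      rw [← Finset.sum_mul, h1, one_mul]
      simp [MDP.bellman]
    · simp [rate, if_neg hv]
  · simp only [mul_pow]
    calc _ ≤ ∑ i ∈ Finset.range n, g.rate k i ω s a ^ 2 * D ^ 2 := by
          refine Finset.sum_le_sum fun i _ => mul_le_mul_of_nonneg_left ?_ (sq_nonneg _)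
          rw [← sq_abs]
          exact pow_le_pow_left₀ (abs_nonneg _) (hnoise _ _ _) 2
      _ = D ^ 2 * ∑ i ∈ Finset.range n, g.rate k i ω s a ^ 2 := by
          rw [← Finset.sum_mul, mul_comm]
      _ ≤ _ := by
          refine mul_le_mul_of_nonneg_left ?_ (sq_nonneg _)
          rw [g.sum_comp_rate k (fun x => x ^ 2) (by simp)]
          exact (hstep2 k s a).sum_le_tsum _ fun _ _ => sq_nonneg _

/-- The Q-tables converge along every run that visits all state-action pairs infinitely often. -/
theorem ae_tendsto_runQ (hstep : ∀ k s a i, 0 ≤ g.step k s a i ∧ g.step k s a i ≤ 1)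
    (hstep1 : ∀ k s a, Tendsto (fun n => ∑ i ∈ Finset.range n, g.step k s a i) atTop atTop)
    (hstep2 : ∀ k s a, Summable (fun i => g.step k s a i ^ 2)) (s₀ : Fin K → S)
    {Q : S → A → ℝ} (hQ : g.mdp.bellman Q = Q) :
    ∀ᵐ ω ∂(g.runLaw q₀ s₀), (∀ s a, ∃ᶠ n in atTop, ω n k = (s, a)) →
      ∀ s a, Tendsto (fun n => g.runQ q₀ n ω k s a) atTop (𝓝 (Q s a)) := by
  have h : ∀ᵐ ω ∂(g.runLaw q₀ s₀), ∀ s a, ∃ c, Tendsto (fun n => ∑ i ∈ Finset.range n,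
      g.rate k i ω s a * g.targetNoise q₀ k i ω (ω (i + 1) k).1 s a) atTop (𝓝 c) :=
    ae_all_iff.2 fun s => ae_all_iff.2 fun a =>
      g.ae_exists_tendsto_sum_noise q₀ k hstep hstep2 s₀ s a
  filter_upwards [h] with ω hω hvis
  obtain ⟨B, hB⟩ := g.exists_abs_Qhat_le hstep k (q₀ k)
  refine tendsto_of_async_contraction g.mdp.γ_pos g.mdp.γ_lt_one (T := g.mdp.bellman)
    (fun Q' d hd s a => ?_) (fun n s a => g.rate_mem k hstep n ω s a)
    (fun s a => g.tendsto_sum_rate_atTop k hstep1 (hvis s a))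
    (fun n s a => g.runQ_succ q₀ k n ω s a) hω ⟨B, fun n s a => hB _ _ n s a⟩
  have := g.mdp.abs_bellman_sub_le hd s a
  rwa [hQ] at this

end GEA

/-! ### The main theorem -/

theorem theorem1 {K : ℕ} {S A : Type*}
    [Fintype S] [Nonempty S] [MeasurableSpace S] [MeasurableSingletonClass S]
    [Fintype A] [Nonempty A] [MeasurableSpace A] [MeasurableSingletonClass A]
    (g : GEA K S A)
    (hα : 0 < g.α ∧ g.α ≤ 1 / 4)
    -- every agent belongs to its own neighbourhood
    (hself : ∀ k, g.graph.Adj k k)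
    -- step sizes
    (hstep01 : ∀ k s a i, 0 ≤ g.step k s a i ∧ g.step k s a i ≤ 1)
    (hstep1 : ∀ k s a, Tendsto (fun n => ∑ i ∈ Finset.range n, g.step k s a i) atTop atTop)
    (hstep2 : ∀ k s a, Summable (fun i => g.step k s a i ^ 2))
    -- initial Q-values
    (hMprob : IsProbabilityMeasure g.M)
    (hMbdd : ∃ B : ℝ, ∀ᵐ x ∂g.M, |x| ≤ B)
    (hMmean : ∫ x, x ∂g.M = 0)
    -- transitions
    (hreach : g.mdp.Reachable)
    -- rewards
    (hrew : ∃ rmin rmax : ℝ, ∀ s a s', rmin ≤ g.mdp.r s a s' ∧ g.mdp.r s a s' ≤ rmax)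
    (s₀ : Fin K → S) :
    ∃ πstar : S → PMF A, g.mdp.IsOptimal πstar ∧
      ∀ᵐ q₀ ∂g.initLaw, ∀ᵐ ω ∂(g.runLaw q₀ s₀), ∀ k : Fin K,
        (∀ s a, ∃ᶠ n in atTop, ω n k = (s, a)) ∧
        (∀ s a, Tendsto (fun n => g.runQ q₀ n ω k s a) atTop (𝓝 (g.mdp.Qval πstar s a))) ∧
        (∀ᶠ n in atTop, ∀ π : S → PMF A, IsGreedy π (g.runQ q₀ n ω k) → g.mdp.IsOptimal π) := by
  have hlim : ∀ k s a, Tendsto (g.step k s a) atTop (𝓝 0) := fun k s a => by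
    have h := (Real.continuous_sqrt.tendsto 0).comp (hstep2 k s a).tendsto_atTop_zero
    simpa [Function.comp_def, Real.sqrt_sq (hstep01 k s a _).1] using h
  obtain ⟨Q, hQ⟩ := g.mdp.exists_bellman_fixedPoint
  obtain ⟨π, hπ⟩ := exists_isGreedy Q
  -- The conclusion is obtained for every initial table, not only for almost every one.
  refine ⟨π, g.mdp.isOptimal_of_isGreedy hQ hπ, ae_of_all _ fun q₀ => ?_⟩
  filter_upwards [g.ae_frequently_pair q₀ hα hself hstep01 hlim hMbdd hMmean hreach s₀,
    ae_all_iff.2 fun k => g.ae_tendsto_runQ q₀ k hstep01 hstep1 hstep2 s₀ hQ] with ω hvis hconv k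
  have hlimQ := hconv k (hvis k)
  refine ⟨hvis k, fun s a => ?_, ?_⟩
  · rw [g.mdp.Qval_eq_of_isGreedy hQ hπ]
    exact hlimQ s a
  · exact (eventually_isGreedy_of_tendsto hlimQ).mono fun n hn π' hπ' =>
      g.mdp.isOptimal_of_isGreedy hQ (hn π' hπ')
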